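/- Let $\mathcal X\subset\mathbb R^m$ and let $f:\mathcal X\to\mathbb R$ belong to a reproducing kernel Hilbert space $\mathcal H$ with measurable reproducing kernel $k$, with $\|f\|_{\mathcal H}\le B$ and $k(x,x)\le 1$ for all $x\in\mathcal X$. Let $d(x,x')=\sqrt{k(x,x)-2k(x,x')+k(x',x')}$ be the kernel metric, and for $\epsilon\in[0,\infty]$ let $\Delta_\epsilon(x)=\{x'-x: x'\in\mathcal X,\ d(x,x')\le\epsilon\}$. Let $0<\lambda\le 1$, $R\ge 0$, $\zeta\in(0,1)$, $p\ge 1$, $T\in\mathbb N$, $\epsilon_1,\dots,\epsilon_T\ge0$. For a function $g:\mathcal X\to\mathbb R$ and $\tau\in\mathbb R$, the $p$-fragility of $x\in\mathcal X$ is the least $\kappa\ge0$ such that $g(x+\delta)\ge\tau-[\kappa\, d(x,x+\delta)]^p$ for all $\delta\in\Delta_\infty(x)$ (and $+\infty$ if there is none). Write $\kappa_{\tau,p}(x)$ for the $p$-fragility for $g=f$, and $\kappa_{\tau,p}=\inf_{x\in\mathcal X}\kappa_{\tau,p}(x)$. Assume that $\tau\le f(x)$ for some $x\in\mathcal X$ and,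 if $p>1$, that $\kappa_{\tau,p}<\infty$. Consider the following interaction (algorithm AdveRS-G). In round $t=1,\dots,T$ the learner selects a point $\tilde x_t\in\mathcal X$ that minimizes over $\mathcal X$ the optimistic $p$-fragility $\overline\kappa_{\tau,p,t}$, that is, the $p$-fragility for $g=\mathrm{ucb}_t$; an adversary selects $\delta_t\in\Delta_{\epsilon_t}(\tilde x_t)$; the point $x_t=\tilde x_t+\delta_t$ is sampled and $y_t=f(x_t)+\eta_t$ is observed. Here $\mathrm{ucb}_t(x)=\mu_{t-1}(x)+\beta_t\sigma_{t-1}(x)$ with $$\mu_{n}(x)=\boldsymbol k_n(x)^\top(\boldsymbol K_n+\lambda \boldsymbol I_n)^{-1}\boldsymbol y_n,\qquad \sigma_n^2(x)=k(x,x)-\boldsymbol k_n(x)^\top(\boldsymbol K_n+\lambda \boldsymbol I_n)^{-1}\boldsymbol k_n(x),$$ $\boldsymbol K_n=[k(x_i,x_j)]_{i,j\le n}$, $\boldsymbol k_n(x)=[k(x_i,x)]_{i\le n}$, $\boldsymbol y_n=[y_i]_{i\le n}$, and, with $\overline\lambda=\max\{1,\lambda\}$, $$\beta_t=B+\frac{R}{\sqrt\lambda}\sqrt{\log\det\Big(\frac{\overline\lambda}{\lambda}\boldsymbol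 K_{t-1}+\overline\lambda \boldsymbol I_{t-1}\Big)+2\log\frac1\zeta}.$$ The noise is conditionally $R$-subgaussian: there is a filtration $(\mathcal F_t)_{t\ge0}$ such that, for $1\le t\le T$, $x_t$ is $\mathcal F_{t-1}$-measurable, $\eta_t$ is $\mathcal F_t$-measurable, and $\mathbb E[e^{s\eta_t}\mid\mathcal F_{t-1}]\le e^{s^2R^2/2}$ almost surely for all $s\in\mathbb R$. Let $$\gamma_T=\sup_{(a_1,\dots,a_T)\in\mathcal X^T}\tfrac12\log\det\big(\boldsymbol I_T+\lambda^{-1}[k(a_i,a_j)]_{i,j\le T}\big)$$ be the maximum information gain. Then, with probability at least $1-\zeta$, $$R^{rs\text{-}g}_T:=\sum_{t=1}^T\big(\tau-[\kappa_{\tau,p}\,\epsilon_t]^p-f(x_t)\big)^+\ \le\ 4\beta_T\sqrt{T\gamma_T}.$$ -/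

import Mathlib

open MeasureTheory
open scoped ENNReal NNReal

namespace AdveRS

noncomputable section

/-! ### Kernels and Gaussian process regression -/

section GP

variable {X : Type*}

/-- The real-valued reproducing kernel `k` of an RKHS `H` of real functions on `X`. -/
def reproducingKernel {X : Type*} (H : Type*) [NormedAddCommGroup H] [InnerProductSpace ℝ H]
    [CompleteSpace H] [RKHS ℝ H X ℝ] (x x' : X) : ℝ :=
  RKHS.kernel H x x' 1

/-- The kernel metric `d(x, x') = √(k(x,x) - 2 k(x,x') + k(x',x'))`. -/
def kernelMetric (k : X → X → ℝ) (x x' : X) : ℝ :=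
  √(k x x - 2 * k x x' + k x' x')

/-- The kernel matrix `K_A` of a tuple `A` of `n` sampling points. -/
def kernelMatrix (k : X → X → ℝ) {n : ℕ} (A : Fin n → X) : Matrix (Fin n) (Fin n) ℝ :=
  Matrix.of fun i j => k (A i) (A j)

/-- The vector `(k(A_i, x))_i`. -/
def kernelVec (k : X → X → ℝ) {n : ℕ} (A : Fin n → X) (x : X) : Fin n → ℝ :=
  fun i => k (A i) x

/-- Posterior mean at `x`, given the observations `y` at the sampling points `A`. -/
def posteriorMean (k : X → X → ℝ) (lam : ℝ) {n : ℕ} (A : Fin n → X) (y : Fin n → ℝ) (x : X) : ℝ :=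
  kernelVec k A x ⬝ᵥ ((kernelMatrix k A + lam • (1 : Matrix (Fin n) (Fin n) ℝ))⁻¹).mulVec y

/-- Posterior covariance of the values at `x` and `x'`, given the sampling points `A`. -/
def posteriorCov (k : X → X → ℝ) (lam : ℝ) {n : ℕ} (A : Fin n → X) (x x' : X) : ℝ :=
  k x x' -
    kernelVec k A x ⬝ᵥ
      ((kernelMatrix k A + lam • (1 : Matrix (Fin n) (Fin n) ℝ))⁻¹).mulVec (kernelVec k A x')

/-- Posterior standard deviation `σ(x)`. -/
def posteriorStd (k : X → X → ℝ) (lam : ℝ) {n : ℕ} (A : Fin n → X) (x : X) : ℝ :=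
  √(posteriorCov k lam A x x)

/-- The exploration parameter computed from the sampling points `A`; the exploration parameter
`β_t` of round `t` is the one computed from the `t - 1` points sampled before round `t`. -/
def explorationParam (k : X → X → ℝ) (lam B R ζ : ℝ) {n : ℕ} (A : Fin n → X) : ℝ :=
  B + R / √lam *
    √(Real.log (Matrix.det ((max 1 lam / lam) • kernelMatrix k A
        + max 1 lam • (1 : Matrix (Fin n) (Fin n) ℝ))) + 2 * Real.log (1 / ζ))

/-- The maximum information gain `γ_n`, over all choices of `n` sampling points (repetitions are
allowed). -/
def maxInfoGain (k : X → X → ℝ) (lam : ℝ) (n : ℕ) : ℝ :=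
  ⨆ A : Fin n → X,
    1 / 2 * Real.log (Matrix.det ((1 : Matrix (Fin n) (Fin n) ℝ) + lam⁻¹ • kernelMatrix k A))

/-- The first `n` terms `z_1, …, z_n` of a sequence indexed by the rounds `1, 2, …`. -/
def firstTerms {α : Type*} (z : ℕ → α) (n : ℕ) : Fin n → α :=
  fun i => z (i + 1)

/-- `β_t`, for the sequence `x_1, x_2, …` of sampled points. -/
def beta (k : X → X → ℝ) (lam B R ζ : ℝ) (x : ℕ → X) (t : ℕ) : ℝ :=
  explorationParam k lam B R ζ (firstTerms x (t - 1))

/-- The upper confidence bound `ucb_t(z) = μ_{t-1}(z) + β_t σ_{t-1}(z)`, for the sequences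
`x_1, x_2, …` of sampled points and `y_1, y_2, …` of observations. -/
def ucb (k : X → X → ℝ) (lam B R ζ : ℝ) (x : ℕ → X) (y : ℕ → ℝ) (t : ℕ) (z : X) : ℝ :=
  posteriorMean k lam (firstTerms x (t - 1)) (firstTerms y (t - 1)) z
    + beta k lam B R ζ x t * posteriorStd k lam (firstTerms x (t - 1)) z

end GP

/-! ### Perturbations and fragilities -/

section Fragility

variable {E : Type*} [AddCommGroup E] {𝒳 : Set E}

/-- The ambiguity ball `Δ_ε(x)`, for a radius `ε` that may be `∞`. -/
def ambiguityBall (d : 𝒳 → 𝒳 → ℝ) (ε : EReal) (x : 𝒳) : Set E :=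
  {δ | ∃ x' : 𝒳, δ = (x' : E) - x ∧ (d x x' : EReal) ≤ ε}

theorem add_mem_of_mem_ambiguityBall {d : 𝒳 → 𝒳 → ℝ} {ε : EReal} {x : 𝒳} {δ : E}
    (h : δ ∈ ambiguityBall d ε x) : (x : E) + δ ∈ 𝒳 := by
  obtain ⟨x', rfl, -⟩ := h
  simp

/-- The action `x + δ` obtained from `x` by a permissible perturbation `δ`. -/
def perturb {d : 𝒳 → 𝒳 → ℝ} {ε : EReal} (x : 𝒳) (δ : ambiguityBall d ε x) : 𝒳 :=
  ⟨(x : E) + δ, add_mem_of_mem_ambiguityBall δ.2⟩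

/-- `κ ≥ 0` is feasible in the problem that defines the `p`-fragility of `x` for the function `g`:
`g(x + δ) ≥ τ - [κ d(x, x + δ)]^p` for all `δ ∈ Δ_∞(x)`. -/
def IsFeasible (d : 𝒳 → 𝒳 → ℝ) (g : 𝒳 → ℝ) (τ p : ℝ) (x : 𝒳) (κ : ℝ≥0) : Prop :=
  ∀ δ : ambiguityBall d ⊤ x, τ - ((κ : ℝ) * d x (perturb x δ)) ^ p ≤ g (perturb x δ)

/-- The `p`-fragility of `x` for the function `g`: the least feasible `κ`, and `∞` if there is
none. -/
def pFragility (d : 𝒳 → 𝒳 → ℝ) (g : 𝒳 → ℝ) (τ p : ℝ) (x : 𝒳) : ℝ≥0∞ :=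
  ⨅ (κ : ℝ≥0) (_ : IsFeasible d g τ p x κ), (κ : ℝ≥0∞)

/-- The least `p`-fragility `κ_{τ,p}` of an action, for the function `g`. -/
def minPFragility (d : 𝒳 → 𝒳 → ℝ) (g : 𝒳 → ℝ) (τ p : ℝ) : ℝ≥0∞ :=
  ⨅ x : 𝒳, pFragility d g τ p x

/-- The RS-G regret `∑_{t=1}^T (τ - [κ_{τ,p} ε_t]^p - f(x_t))⁺`; it is meant for `κ_{τ,p} < ∞`. -/
def rsgRegret (d : 𝒳 → 𝒳 → ℝ) (f : 𝒳 → ℝ) (τ p : ℝ) (ε : ℕ → ℝ) (x : ℕ → 𝒳) (T : ℕ) : ℝ :=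
  ∑ t ∈ Finset.Icc 1 T, max (τ - ((minPFragility d f τ p).toReal * ε t) ^ p - f (x t)) 0

/-- The sequences of selected points `xSel` (the `x̃_t`), perturbations `δ`, sampled points `x` and
observations `y` form a run of AdveRS-G over the rounds `1, …, T`, on the function `f` with noise
`η` and perturbation budgets `ε`, where `d` is the kernel metric. -/
structure IsAdveRSGRun (k : 𝒳 → 𝒳 → ℝ) (lam B R ζ τ p : ℝ) (f : 𝒳 → ℝ) (ε : ℕ → ℝ) (T : ℕ)
    (xSel : ℕ → 𝒳) (δ : ℕ → E) (x : ℕ → 𝒳) (y η : ℕ → ℝ) : Prop where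
  /-- The learner selects a minimizer of the optimistic `p`-fragility. -/
  selected : ∀ t ∈ Finset.Icc 1 T, ∀ z : 𝒳,
    pFragility (kernelMetric k) (ucb k lam B R ζ x y t) τ p (xSel t)
      ≤ pFragility (kernelMetric k) (ucb k lam B R ζ x y t) τ p z
  /-- The adversary respects its budget. -/
  perturbation : ∀ t ∈ Finset.Icc 1 T, δ t ∈ ambiguityBall (kernelMetric k) (ε t) (xSel t)
  /-- The perturbed point is sampled. -/
  sampled : ∀ t ∈ Finset.Icc 1 T, (x t : E) = xSel t + δ t
  /-- A noisy value is observed. -/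
  observed : ∀ t ∈ Finset.Icc 1 T, y t = f (x t) + η t

end Fragility

/-! ### Noise -/

/-- `Z` is conditionally `R`-subgaussian given the σ-algebra `m`:
`𝔼[exp(s Z) | m] ≤ exp(s² R² / 2)` almost surely, for every real `s`. (Unlike
`ProbabilityTheory.HasCondSubgaussianMGF`, this does not ask for a standard Borel space.) -/
def IsCondSubgaussian {Ω : Type*} {mΩ : MeasurableSpace Ω} (P : Measure Ω) (m : MeasurableSpace Ω)
    (Z : Ω → ℝ) (R : ℝ) : Prop :=
  ∀ s : ℝ, Integrable (fun ω => Real.exp (s * Z ω)) P ∧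
    P[fun ω => Real.exp (s * Z ω) | m] ≤ᵐ[P] fun _ => Real.exp (s ^ 2 * R ^ 2 / 2)

end

end AdveRS

/-! The randomness enters through one event: for all `n ≤ T`, the energy `eᵀ K (K + λ I)⁻¹ e` of the
first `n` noise terms is at most `R² (log det (I + λ⁻¹ K) + 2 log (1/ζ))`. On it the regret bound is
deterministic.

The event has probability at least `1 - ζ`. For `R > 0`, the exponential of energy`/(2R²)` minus
half the log-determinant is a nonnegative supermartingale started at 1: by the rank-one recursions
`noiseEnergy_succ` and `logDet_succ`, each step multiplies it by a Gaussian mixture of `exp (θ η/R -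
θ²/2)` with predictable mean and variance. Ville's inequality bounds its running maximum.

On the event, Cauchy–Schwarz in feature space (`abs_sub_posteriorMean_le`) gives `|f - μ| ≤ β σ`.
Hence `ucb ≥ f`, so the optimistic fragility of the selected point is at most `κ_{τ,p}`, and `ucb_t
(x_t) ≥ τ - [κ_{τ,p} ε_t]^p` whatever the adversary does. Each regret term is then at most `2 β_T
σ_{t-1}(x_t)`. The posterior variances at the sampled points sum to at most `4 γ_T`, because their
logarithms telescope to the log-determinant, and Cauchy–Schwarz over the rounds finishes. -/

namespace AdveRS

/-! ### Kernel ridge regression in feature space. -/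

section Posterior

variable {X : Type*} {H : Type*} [NormedAddCommGroup H] [InnerProductSpace ℝ H]

open scoped RealInnerProductSpace
open Matrix

/-- The regularized kernel matrix `K_A + λ I`. -/
def regKernelMatrix (k : X → X → ℝ) (lam : ℝ) {n : ℕ} (A : Fin n → X) : Matrix (Fin n) (Fin n) ℝ :=
  kernelMatrix k A + lam • (1 : Matrix (Fin n) (Fin n) ℝ)

/-- The energy `eᵀ K_A (K_A + λ I)⁻¹ e` of a noise vector `e`, written without `K_A`. -/
noncomputable def noiseEnergy (k : X → X → ℝ) (lam : ℝ) {n : ℕ} (A : Fin n → X) (e : Fin n → ℝ) : ℝ :=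
  e ⬝ᵥ e - lam * (e ⬝ᵥ (regKernelMatrix k lam A)⁻¹ *ᵥ e)

/-- Twice the information gain `log det (I + λ⁻¹ K_A)`. -/
noncomputable def logDet (k : X → X → ℝ) (lam : ℝ) {n : ℕ} (A : Fin n → X) : ℝ :=
  Real.log (det ((1 : Matrix (Fin n) (Fin n) ℝ) + lam⁻¹ • kernelMatrix k A))

variable {k : X → X → ℝ} {φ : X → H} {lam : ℝ} {n : ℕ}

theorem regKernelMatrix_posDef (hk : ∀ x x', k x x' = ⟪φ x, φ x'⟫) (hlam : 0 < lam)
    (A : Fin n → X) : (regKernelMatrix k lam A).PosDef := by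
  have h : kernelMatrix k A = Matrix.gram ℝ (φ ∘ A) := by
    ext i j
    simp [kernelMatrix, hk, Matrix.gram_apply]
  rw [regKernelMatrix, h]
  exact (PosDef.one.smul hlam).posSemidef_add (Matrix.posSemidef_gram ℝ _)

theorem regKernelMatrix_mulVec (A : Fin n → X) (u : Fin n → ℝ) (i : Fin n) :
    (regKernelMatrix k lam A *ᵥ u) i = ∑ j, k (A i) (A j) * u j + lam * u i := by
  rw [regKernelMatrix, add_mulVec, smul_mulVec, one_mulVec]
  simp [kernelMatrix, mulVec, dotProduct]

theorem regKernelMatrix_mulVec_inv (hk : ∀ x x', k x x' = ⟪φ x, φ x'⟫) (hlam : 0 < lam)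
    (A : Fin n → X) (v : Fin n → ℝ) :
    regKernelMatrix k lam A *ᵥ ((regKernelMatrix k lam A)⁻¹ *ᵥ v) = v := by
  rw [mulVec_mulVec, mul_nonsing_inv _
    ((isUnit_iff_isUnit_det _).1 (regKernelMatrix_posDef hk hlam A).isUnit), one_mulVec]

theorem regKernelMatrix_inv_mulVec_eq (hk : ∀ x x', k x x' = ⟪φ x, φ x'⟫) (hlam : 0 < lam)
    (A : Fin n → X) {u v : Fin n → ℝ} (h : regKernelMatrix k lam A *ᵥ u = v) :
    (regKernelMatrix k lam A)⁻¹ *ᵥ v = u := by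
  rw [← h, mulVec_mulVec, nonsing_inv_mul _
    ((isUnit_iff_isUnit_det _).1 (regKernelMatrix_posDef hk hlam A).isUnit), one_mulVec]

theorem dotProduct_regKernelMatrix_inv_comm (hk : ∀ x x', k x x' = ⟪φ x, φ x'⟫) (hlam : 0 < lam)
    (A : Fin n → X) (u v : Fin n → ℝ) :
    u ⬝ᵥ (regKernelMatrix k lam A)⁻¹ *ᵥ v = v ⬝ᵥ (regKernelMatrix k lam A)⁻¹ *ᵥ u := by
  have h : ((regKernelMatrix k lam A)⁻¹)ᵀ = (regKernelMatrix k lam A)⁻¹ := by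
    simpa [IsHermitian] using (regKernelMatrix_posDef hk hlam A).inv.isHermitian
  rw [dotProduct_mulVec, ← mulVec_transpose, h, dotProduct_comm]

theorem posteriorCov_self_le (hk : ∀ x x', k x x' = ⟪φ x, φ x'⟫) (hlam : 0 < lam)
    (A : Fin n → X) (x : X) : posteriorCov k lam A x x ≤ k x x := by
  have := (regKernelMatrix_posDef hk hlam A).inv.posSemidef.dotProduct_mulVec_nonneg
    (kernelVec k A x)
  simp only [star_trivial] at this
  simpa [posteriorCov, regKernelMatrix] using this

/-- The residual `r` of `φ x` after kernel ridge regression on the points `A`, together with the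
regression coefficients `c`. -/
theorem exists_residual (hk : ∀ x x', k x x' = ⟪φ x, φ x'⟫) (hlam : 0 < lam)
    (A : Fin n → X) (x : X) :
    ∃ (c : Fin n → ℝ) (r : H), c = (regKernelMatrix k lam A)⁻¹ *ᵥ kernelVec k A x ∧
      (∀ h : H, ⟪φ x, h⟫ = ⟪r, h⟫ + ∑ i, c i * ⟪φ (A i), h⟫) ∧
      posteriorCov k lam A x x = ‖r‖ ^ 2 + lam * ∑ i, c i ^ 2 := by
  set c := (regKernelMatrix k lam A)⁻¹ *ᵥ kernelVec k A x with hc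
  let r : H := φ x - ∑ i, c i • φ (A i)
  have h1 : ∀ h : H, ⟪φ x, h⟫ = ⟪r, h⟫ + ∑ i, c i * ⟪φ (A i), h⟫ := by
    intro h
    simp [r, inner_sub_left, sum_inner, real_inner_smul_left]
  -- Normal equations: regularization leaves `r` not orthogonal to the features, and the defect `lam
  -- * c j` produces the second term of the variance.
  have h2 : ∀ j, ⟪φ (A j), r⟫ = lam * c j := by
    intro j
    have := congrFun (regKernelMatrix_mulVec_inv hk hlam A (kernelVec k A x)) j
    rw [← hc, regKernelMatrix_mulVec] at this
    simp only [r, inner_sub_right, inner_sum, real_inner_smul_right]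
    simp only [kernelVec, hk] at this
    rw [← this]
    simp [mul_comm]
  refine ⟨c, r, hc, h1, ?_⟩
  have h3 : posteriorCov k lam A x x = ⟪φ x, r⟫ := by
    simp only [r, inner_sub_right, inner_sum, real_inner_smul_right]
    rw [posteriorCov, ← hk, ← regKernelMatrix, ← hc]
    congr 1
    refine Finset.sum_congr rfl fun i _ => ?_
    rw [kernelVec, hk, real_inner_comm, mul_comm]
  rw [h3, h1 r, real_inner_self_eq_norm_sq, Finset.mul_sum]
  congr 1
  refine Finset.sum_congr rfl fun i _ => ?_
  rw [h2]; ring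

theorem posteriorCov_self_nonneg (hk : ∀ x x', k x x' = ⟪φ x, φ x'⟫) (hlam : 0 < lam)
    (A : Fin n → X) (x : X) : 0 ≤ posteriorCov k lam A x x := by
  obtain ⟨c, r, -, -, h⟩ := exists_residual hk hlam A x
  rw [h]
  positivity

/-- Cauchy–Schwarz in `H ⊕ ℝⁿ`: with `u = (K + λ I)⁻¹ e`, `h = ∑ uᵢ φ(Aᵢ)` and `w = K u`, the mean
is the pairing of `(r, √λ c)` with `(h, w/√λ)`, whose squared norms are the two factors on the
right. -/
theorem sq_posteriorMean_le (hk : ∀ x x', k x x' = ⟪φ x, φ x'⟫) (hlam : 0 < lam)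
    (A : Fin n → X) (e : Fin n → ℝ) (x : X) :
    (posteriorMean k lam A e x) ^ 2
      ≤ posteriorCov k lam A x x * (noiseEnergy k lam A e / lam) := by
  obtain ⟨c, r, -, h1, h2⟩ := exists_residual hk hlam A x
  set u := (regKernelMatrix k lam A)⁻¹ *ᵥ e with hu
  let h : H := ∑ i, u i • φ (A i)
  let w : Fin n → ℝ := fun i => ⟪φ (A i), h⟫
  have he : ∀ i, e i = w i + lam * u i := by
    intro i
    have := congrFun (regKernelMatrix_mulVec_inv hk hlam A e) i
    rw [← hu, regKernelMatrix_mulVec] at this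
    rw [← this]
    simp [w, h, inner_sum, real_inner_smul_right, hk, mul_comm]
  have hh : ‖h‖ ^ 2 = ∑ i, u i * w i := by
    rw [← real_inner_self_eq_norm_sq]
    conv_lhs => enter [2]; simp only [h]
    rw [sum_inner]
    simp only [real_inner_smul_left, w]
  have hq : noiseEnergy k lam A e / lam = ‖h‖ ^ 2 + ∑ i, w i ^ 2 / lam := by
    rw [hh, noiseEnergy, ← hu, dotProduct, dotProduct, Finset.mul_sum, ← Finset.sum_sub_distrib,
      Finset.sum_div, ← Finset.sum_add_distrib]
    refine Finset.sum_congr rfl fun i _ => ?_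
    rw [he]; field_simp; ring
  have hm : posteriorMean k lam A e x = ⟪r, h⟫ + ∑ i, c i * w i := by
    rw [← h1, posteriorMean, ← regKernelMatrix, ← hu, dotProduct]
    simp [h, inner_sum, real_inner_smul_right, kernelVec, hk, mul_comm, real_inner_comm]
  have hcs : (∑ i, c i * w i) ^ 2 ≤ (lam * ∑ i, c i ^ 2) * (∑ i, w i ^ 2 / lam) := by
    refine (Finset.sum_mul_sq_le_sq_mul_sq _ _ _).trans (le_of_eq ?_)
    rw [← Finset.sum_div]; field_simp
  have hr : ⟪r, h⟫ ^ 2 ≤ ‖r‖ ^ 2 * ‖h‖ ^ 2 := by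
    rw [← mul_pow, ← sq_abs]
    exact pow_le_pow_left₀ (abs_nonneg _) (abs_real_inner_le_norm r h) 2
  rw [hm, hq, h2]
  have ha : 0 ≤ lam * ∑ i, c i ^ 2 := by positivity
  have hb : 0 ≤ ∑ i, w i ^ 2 / lam := by positivity
  set a := lam * ∑ i, c i ^ 2
  set b := ∑ i, w i ^ 2 / lam
  have hcross : 2 * (⟪r, h⟫ * ∑ i, c i * w i) ≤ ‖r‖ ^ 2 * b + a * ‖h‖ ^ 2 := by
    apply abs_le_of_sq_le_sq' _ (by positivity) |>.2
    calc (2 * (⟪r, h⟫ * ∑ i, c i * w i)) ^ 2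
        = 4 * (⟪r, h⟫ ^ 2 * (∑ i, c i * w i) ^ 2) := by ring
      _ ≤ 4 * ((‖r‖ ^ 2 * ‖h‖ ^ 2) * (a * b)) := by gcongr
      _ ≤ (‖r‖ ^ 2 * b + a * ‖h‖ ^ 2) ^ 2 := by
        nlinarith [sq_nonneg (‖r‖ ^ 2 * b - a * ‖h‖ ^ 2)]
  nlinarith

/-- The error is exactly `⟪r, f⟫`, and `‖r‖² ≤ σ²` since the variance is `‖r‖² + λ ∑ cᵢ²`. -/
theorem abs_sub_posteriorMean_noiseless_le (hk : ∀ x x', k x x' = ⟪φ x, φ x'⟫) (hlam : 0 < lam)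
    (A : Fin n → X) (f : H) (x : X) :
    |⟪φ x, f⟫ - posteriorMean k lam A (fun i => ⟪φ (A i), f⟫) x|
      ≤ ‖f‖ * posteriorStd k lam A x := by
  obtain ⟨c, r, hc, h1, h2⟩ := exists_residual hk hlam A x
  have hm : posteriorMean k lam A (fun i => ⟪φ (A i), f⟫) x = ∑ i, c i * ⟪φ (A i), f⟫ := by
    rw [posteriorMean, ← regKernelMatrix, dotProduct_regKernelMatrix_inv_comm hk hlam, ← hc,
      dotProduct_comm, dotProduct]
  rw [hm, h1, add_sub_cancel_right, mul_comm]
  refine (abs_real_inner_le_norm r f).trans ?_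
  gcongr
  rw [posteriorStd]
  apply Real.le_sqrt_of_sq_le
  rw [h2]
  have : 0 ≤ lam * ∑ i, c i ^ 2 := by positivity
  linarith

theorem abs_sub_posteriorMean_le (hk : ∀ x x', k x x' = ⟪φ x, φ x'⟫) (hlam : 0 < lam)
    (A : Fin n → X) (f : H) (e : Fin n → ℝ) (x : X) :
    |⟪φ x, f⟫ - posteriorMean k lam A (fun i => ⟪φ (A i), f⟫ + e i) x|
      ≤ (‖f‖ + √(noiseEnergy k lam A e / lam)) * posteriorStd k lam A x := by
  have hadd : posteriorMean k lam A (fun i => ⟪φ (A i), f⟫ + e i) x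
      = posteriorMean k lam A (fun i => ⟪φ (A i), f⟫) x + posteriorMean k lam A e x := by
    rw [posteriorMean, posteriorMean, posteriorMean, ← dotProduct_add, ← mulVec_add]
    rfl
  have h1 := abs_sub_posteriorMean_noiseless_le hk hlam A f x
  have h2 : |posteriorMean k lam A e x|
      ≤ √(noiseEnergy k lam A e / lam) * posteriorStd k lam A x := by
    rw [mul_comm, posteriorStd, ← Real.sqrt_mul (posteriorCov_self_nonneg hk hlam A x)]
    exact Real.abs_le_sqrt (sq_posteriorMean_le hk hlam A e x)
  rw [hadd, ← sub_sub, add_mul]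
  exact (abs_sub _ _).trans (add_le_add h1 h2)

/-! ### Recursions in the number of sampling points -/

/-- Block elimination in the bordered system: the new point enters only through its prediction error
and the Schur complement `s + lam`. -/
theorem noiseEnergy_succ (hk : ∀ x x', k x x' = ⟪φ x, φ x'⟫) (hlam : 0 < lam)
    (A : Fin (n + 1) → X) (e : Fin (n + 1) → ℝ) :
    noiseEnergy k lam A e = noiseEnergy k lam (fun i : Fin n => A i.castSucc) (fun i => e i.castSucc)
      + (e (Fin.last n) ^ 2 - lam * (e (Fin.last n)
          - posteriorMean k lam (fun i : Fin n => A i.castSucc) (fun i => e i.castSucc)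
            (A (Fin.last n))) ^ 2
        / (posteriorCov k lam (fun i : Fin n => A i.castSucc) (A (Fin.last n)) (A (Fin.last n))
            + lam)) := by
  set A' : Fin n → X := fun i => A i.castSucc with hA'
  set e' : Fin n → ℝ := fun i => e i.castSucc with he'
  set a := A (Fin.last n)
  set b := e (Fin.last n)
  set m := posteriorMean k lam A' e' a with hm
  set s := posteriorCov k lam A' a a with hs
  have hs0 : 0 ≤ s := posteriorCov_self_nonneg hk hlam A' a
  set G := (regKernelMatrix k lam A')⁻¹
  set g := G *ᵥ e' with hg
  set c := G *ᵥ kernelVec k A' a with hc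
  -- The last coordinate of the new solution; the old coordinates `g` are corrected by `-t * c`.
  set t := (b - m) / (s + lam) with ht
  have hsym : ∀ x x', k x x' = k x' x := fun x x' => by rw [hk, hk, real_inner_comm]
  have hts : t * (s + lam) = b - m := by rw [ht]; field_simp
  have hm' : m = ∑ i, k (A' i) a * g i := rfl
  have hs' : s = k a a - ∑ i, k (A' i) a * c i := rfl
  have hec : ∑ i, e' i * c i = m := by
    change e' ⬝ᵥ c = _
    rw [hc, dotProduct_regKernelMatrix_inv_comm hk hlam]
    rfl
  have hsol : (regKernelMatrix k lam A)⁻¹ *ᵥ e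
      = Fin.snoc (α := fun _ => ℝ) (fun i => g i - t * c i) t := by
    apply regKernelMatrix_inv_mulVec_eq hk hlam
    ext i
    rw [regKernelMatrix_mulVec, Fin.sum_univ_castSucc]
    refine Fin.lastCases ?_ (fun i => ?_) i
    · simp only [Fin.snoc_last, Fin.snoc_castSucc]
      have : ∑ j : Fin n, k a (A' j) * (g j - t * c j) = m - t * (k a a - s) := by
        rw [hm', hs', sub_sub_cancel, Finset.mul_sum, ← Finset.sum_sub_distrib]
        refine Finset.sum_congr rfl fun j _ => ?_
        rw [hsym a]; ring
      change ∑ j : Fin n, k a (A' j) * (g j - t * c j) + k a a * t + lam * t = b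
      rw [this]; linarith
    · simp only [Fin.snoc_last, Fin.snoc_castSucc]
      have h1 := congrFun (regKernelMatrix_mulVec_inv hk hlam A' e') i
      have h2 := congrFun (regKernelMatrix_mulVec_inv hk hlam A' (kernelVec k A' a)) i
      rw [regKernelMatrix_mulVec] at h1 h2
      change ∑ j, k (A' i) (A' j) * g j + lam * g i = e' i at h1
      change ∑ j, k (A' i) (A' j) * c j + lam * c i = k (A' i) a at h2
      have : ∑ j : Fin n, k (A' i) (A' j) * (g j - t * c j)
          = ∑ j, k (A' i) (A' j) * g j - t * ∑ j, k (A' i) (A' j) * c j := by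
        rw [Finset.mul_sum, ← Finset.sum_sub_distrib]
        exact Finset.sum_congr rfl fun j _ => by ring
      change ∑ j : Fin n, k (A' i) (A' j) * (g j - t * c j) + k (A' i) a * t
        + lam * (g i - t * c i) = e' i
      rw [this]; linear_combination h1 - t * h2
  have hdot : e ⬝ᵥ Fin.snoc (α := fun _ => ℝ) (fun i => g i - t * c i) t
      = e' ⬝ᵥ g - t * m + b * t := by
    rw [← hec, dotProduct, Fin.sum_univ_castSucc, dotProduct, Finset.mul_sum,
      ← Finset.sum_sub_distrib]
    simp only [Fin.snoc_last, Fin.snoc_castSucc]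
    congr 1
    refine Finset.sum_congr rfl fun j _ => ?_
    simp only [he']; ring
  have hee : e ⬝ᵥ e = e' ⬝ᵥ e' + b * b := by
    rw [dotProduct, Fin.sum_univ_castSucc]; rfl
  rw [noiseEnergy, noiseEnergy, hsol, hdot, hee]
  have : lam * (b - m) ^ 2 / (s + lam) = lam * t * (b - m) := by rw [ht]; field_simp
  rw [this]; ring

/-- The last factor is the Schur complement of the leading `n × n` block. -/
theorem det_regKernelMatrix_succ (hk : ∀ x x', k x x' = ⟪φ x, φ x'⟫) (hlam : 0 < lam)
    (A : Fin (n + 1) → X) :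
    (regKernelMatrix k lam A).det = (regKernelMatrix k lam (fun i : Fin n => A i.castSucc)).det
      * (posteriorCov k lam (fun i : Fin n => A i.castSucc) (A (Fin.last n)) (A (Fin.last n))
          + lam) := by
  set A' : Fin n → X := fun i => A i.castSucc with hA'
  set a := A (Fin.last n)
  have hsym : ∀ x x', k x x' = k x' x := fun x x' => by rw [hk, hk, real_inner_comm]
  have hblock : (regKernelMatrix k lam A).submatrix finSumFinEquiv finSumFinEquiv
      = fromBlocks (regKernelMatrix k lam A') (replicateCol (Fin 1) (kernelVec k A' a))
          (replicateRow (Fin 1) (kernelVec k A' a))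
          (Matrix.of fun _ _ => k a a + lam) := by
    ext (i | i) (j | j)
    · simp [regKernelMatrix, kernelMatrix, Matrix.one_apply, A']
      rfl
    · obtain rfl := Fin.fin_one_eq_zero j
      have : Fin.castAdd 1 i ≠ Fin.natAdd n 0 := by
        intro h
        have := congrArg Fin.val h
        simp at this
        omega
      simp [regKernelMatrix, kernelMatrix, this, kernelVec]
      rfl
    · obtain rfl := Fin.fin_one_eq_zero i
      have : Fin.natAdd n 0 ≠ Fin.castAdd 1 j := by
        intro h
        have := congrArg Fin.val h
        simp at this
        omega
      simp [regKernelMatrix, kernelMatrix, this, kernelVec]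
      rw [hsym]
      rfl
    · obtain rfl := Fin.fin_one_eq_zero i
      obtain rfl := Fin.fin_one_eq_zero j
      simp [regKernelMatrix, kernelMatrix]
      rfl
  rw [← det_submatrix_equiv_self finSumFinEquiv (regKernelMatrix k lam A), hblock]
  have : Invertible (regKernelMatrix k lam A') :=
    (regKernelMatrix_posDef hk hlam A').isUnit.invertible
  rw [det_fromBlocks₁₁, det_fin_one, invOf_eq_nonsing_inv]
  congr 1
  rw [Matrix.sub_apply, Matrix.mul_assoc, Matrix.mul_apply, posteriorCov, ← regKernelMatrix, dotProduct]
  simp only [Matrix.mul_apply, mulVec, dotProduct, of_apply, replicateRow_apply,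
    replicateCol_apply]
  ring

theorem one_add_kernelMatrix_eq (hlam : 0 < lam) (A : Fin n → X) :
    (1 : Matrix (Fin n) (Fin n) ℝ) + lam⁻¹ • kernelMatrix k A
      = lam⁻¹ • regKernelMatrix k lam A := by
  rw [regKernelMatrix, smul_add, smul_smul, inv_mul_cancel₀ hlam.ne', one_smul, add_comm]

theorem det_one_add_pos (hk : ∀ x x', k x x' = ⟪φ x, φ x'⟫) (hlam : 0 < lam) (A : Fin n → X) :
    0 < det ((1 : Matrix (Fin n) (Fin n) ℝ) + lam⁻¹ • kernelMatrix k A) := by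
  rw [one_add_kernelMatrix_eq hlam]
  exact ((regKernelMatrix_posDef hk hlam A).smul (inv_pos.2 hlam)).det_pos

theorem det_one_add_succ (hk : ∀ x x', k x x' = ⟪φ x, φ x'⟫) (hlam : 0 < lam)
    (A : Fin (n + 1) → X) :
    det ((1 : Matrix (Fin (n + 1)) (Fin (n + 1)) ℝ) + lam⁻¹ • kernelMatrix k A)
      = det ((1 : Matrix (Fin n) (Fin n) ℝ) + lam⁻¹ • kernelMatrix k (fun i => A i.castSucc))
      * (1 + posteriorCov k lam (fun i : Fin n => A i.castSucc) (A (Fin.last n)) (A (Fin.last n))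
          / lam) := by
  rw [one_add_kernelMatrix_eq hlam, one_add_kernelMatrix_eq hlam, det_smul, det_smul,
    det_regKernelMatrix_succ hk hlam, Fintype.card_fin, Fintype.card_fin, pow_succ]
  field_simp
  ring

theorem logDet_succ (hk : ∀ x x', k x x' = ⟪φ x, φ x'⟫) (hlam : 0 < lam)
    (A : Fin (n + 1) → X) :
    logDet k lam A = logDet k lam (fun i : Fin n => A i.castSucc)
      + Real.log (1 + posteriorCov k lam (fun i : Fin n => A i.castSucc)
          (A (Fin.last n)) (A (Fin.last n)) / lam) := by
  rw [logDet, det_one_add_succ hk hlam, Real.log_mul (det_one_add_pos hk hlam _).ne', logDet]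
  have := posteriorCov_self_nonneg hk hlam (fun i : Fin n => A i.castSucc) (A (Fin.last n))
  positivity

theorem log_one_add_posteriorCov_nonneg (hk : ∀ x x', k x x' = ⟪φ x, φ x'⟫) (hlam : 0 < lam)
    (A : Fin n → X) (x : X) : 0 ≤ Real.log (1 + posteriorCov k lam A x x / lam) := by
  apply Real.log_nonneg
  have := posteriorCov_self_nonneg hk hlam A x
  have : 0 ≤ posteriorCov k lam A x x / lam := by positivity
  linarith

theorem logDet_firstTerms_mono (hk : ∀ x x', k x x' = ⟪φ x, φ x'⟫) (hlam : 0 < lam)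
    (x : ℕ → X) : Monotone fun n => logDet k lam (firstTerms x n) := by
  refine monotone_nat_of_le_succ fun n => ?_
  rw [logDet_succ hk hlam (firstTerms x (n + 1))]
  exact le_add_of_nonneg_right (log_one_add_posteriorCov_nonneg hk hlam _ _)

theorem logDet_zero (A : Fin 0 → X) : logDet k lam A = 0 := by
  simp [logDet]

/-- A crude bound, which makes the supremum in `maxInfoGain` one of a bounded family; a real `⨆` of
an unbounded family would be `0`. -/
theorem logDet_le (hk : ∀ x x', k x x' = ⟪φ x, φ x'⟫) (hlam : 0 < lam) (hk1 : ∀ x, k x x ≤ 1)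
    {n : ℕ} (A : Fin n → X) : logDet k lam A ≤ n * Real.log (1 + 1 / lam) := by
  induction n with
  | zero => simp [logDet_zero]
  | succ n ih =>
    rw [logDet_succ hk hlam, Nat.cast_succ, add_mul, one_mul]
    refine add_le_add (ih _) ?_
    have h0 := posteriorCov_self_nonneg hk hlam (fun i : Fin n => A i.castSucc) (A (Fin.last n))
    have h1 := (posteriorCov_self_le hk hlam (fun i : Fin n => A i.castSucc) (A (Fin.last n))).trans
      (hk1 _)
    apply Real.log_le_log (by positivity)
    gcongr

theorem logDet_le_maxInfoGain (hk : ∀ x x', k x x' = ⟪φ x, φ x'⟫) (hlam : 0 < lam)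
    (hk1 : ∀ x, k x x ≤ 1) (A : Fin n → X) :
    logDet k lam A ≤ 2 * maxInfoGain k lam n := by
  have : BddAbove (Set.range fun A : Fin n → X => 1 / 2 * logDet k lam A) := by
    refine ⟨1 / 2 * (n * Real.log (1 + 1 / lam)), ?_⟩
    rintro _ ⟨A, rfl⟩
    have := logDet_le hk hlam hk1 A
    dsimp only
    linarith
  have := le_ciSup this A
  change _ ≤ maxInfoGain k lam n at this
  linarith

/-- Each variance `s` lies in `[0, 1]`, so `s/2 ≤ s/(1 + s) ≤ log (1 + s) ≤ log (1 + s/λ)` as `λ ≤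
1`; these logarithms telescope. -/
theorem sum_posteriorCov_le (hk : ∀ x x', k x x' = ⟪φ x, φ x'⟫) (hlam : 0 < lam)
    (hlam1 : lam ≤ 1) (hk1 : ∀ x, k x x ≤ 1) (x : ℕ → X) (T : ℕ) :
    ∑ t ∈ Finset.range T, posteriorCov k lam (firstTerms x t) (x (t + 1)) (x (t + 1))
      ≤ 2 * logDet k lam (firstTerms x T) := by
  induction T with
  | zero => simp [logDet_zero]
  | succ T ih =>
    rw [Finset.sum_range_succ, logDet_succ hk hlam (firstTerms x (T + 1)), mul_add]
    refine add_le_add ih ?_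
    change _ ≤ 2 * Real.log (1 + posteriorCov k lam (firstTerms x T) (x (T + 1)) (x (T + 1)) / lam)
    have h0 := posteriorCov_self_nonneg hk hlam (firstTerms x T) (x (T + 1))
    have h1 := (posteriorCov_self_le hk hlam (firstTerms x T) (x (T + 1))).trans (hk1 _)
    set s := posteriorCov k lam (firstTerms x T) (x (T + 1)) (x (T + 1))
    have h2 : Real.log (1 + s) ≤ Real.log (1 + s / lam) := by
      apply Real.log_le_log (by positivity)
      gcongr
      exact le_div_self h0 hlam hlam1
    have h3 := Real.one_sub_inv_le_log_of_pos (x := 1 + s) (by positivity)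
    have h4 : s / 2 ≤ 1 - (1 + s)⁻¹ := by
      rw [show 1 - (1 + s)⁻¹ = s / (1 + s) by field_simp; ring]
      gcongr
      linarith
    linarith

end Posterior

end AdveRS

namespace AdveRS

/-! ### Exponential moments of conditionally subgaussian noise. -/

section Noise

open ProbabilityTheory

variable {Ω : Type*} {m mΩ : MeasurableSpace Ω} {P : Measure Ω} [IsProbabilityMeasure P]
  {Z : Ω → ℝ} {R : ℝ}

theorem IsCondSubgaussian.setLIntegral_exp_le (hm : m ≤ mΩ) (h : IsCondSubgaussian P m Z R)
    (s : ℝ) {A : Set Ω} (hA : MeasurableSet[m] A) :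
    ∫⁻ ω in A, ENNReal.ofReal (Real.exp (s * Z ω - s ^ 2 * R ^ 2 / 2)) ∂P ≤ P A := by
  obtain ⟨hint, hle⟩ := h s
  have h1 : ∫ ω in A, Real.exp (s * Z ω) ∂P ≤ Real.exp (s ^ 2 * R ^ 2 / 2) * P.real A := by
    rw [← setIntegral_condExp hm hint hA]
    calc ∫ ω in A, (P[fun ω => Real.exp (s * Z ω) | m]) ω ∂P
        ≤ ∫ _ in A, Real.exp (s ^ 2 * R ^ 2 / 2) ∂P :=
          setIntegral_mono_ae integrable_condExp.integrableOn (integrable_const _).integrableOn hle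
      _ = _ := by rw [setIntegral_const, smul_eq_mul, mul_comm]
  simp only [Real.exp_sub]
  rw [← ofReal_integral_eq_lintegral_ofReal (hint.div_const _).integrableOn
    (Filter.Eventually.of_forall fun ω => by positivity), integral_div]
  refine (ENNReal.ofReal_le_ofReal (q := P.real A) ?_).trans_eq (by simp)
  rw [div_le_iff₀ (Real.exp_pos _)]
  linarith

/-- The bound on `m`-measurable sets compares two measures on `m`, hence the integrals of any
`m`-measurable `W`, with no integrability required. -/
theorem IsCondSubgaussian.lintegral_mul_exp_const_le (hm : m ≤ mΩ)
    (h : IsCondSubgaussian P m Z R) (hZ : Measurable Z) (s : ℝ) {W : Ω → ℝ≥0∞}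
    (hW : Measurable[m] W) :
    ∫⁻ ω, W ω * ENNReal.ofReal (Real.exp (s * Z ω - s ^ 2 * R ^ 2 / 2)) ∂P ≤ ∫⁻ ω, W ω ∂P := by
  set F : Ω → ℝ≥0∞ := fun ω => ENNReal.ofReal (Real.exp (s * Z ω - s ^ 2 * R ^ 2 / 2))
  have hF : Measurable F := by fun_prop
  have htrim : (P.withDensity F).trim hm ≤ P.trim hm := by
    refine Measure.le_iff.2 fun A hA => ?_
    rw [trim_measurableSet_eq hm hA, trim_measurableSet_eq hm hA, withDensity_apply _ (hm _ hA)]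
    exact h.setLIntegral_exp_le hm s hA
  calc ∫⁻ ω, W ω * F ω ∂P = ∫⁻ ω, W ω ∂(P.withDensity F) := by
        rw [lintegral_withDensity_eq_lintegral_mul _ hF (hW.mono hm le_rfl)]
        simp [mul_comm]
    _ = ∫⁻ ω, W ω ∂((P.withDensity F).trim hm) := (lintegral_trim hm hW).symm
    _ ≤ ∫⁻ ω, W ω ∂(P.trim hm) := lintegral_mono' htrim le_rfl
    _ = _ := lintegral_trim hm hW

/-- On each level set of `Θ` the multiplier is constant, and the indicator of that set is absorbed
into `W`. -/
theorem IsCondSubgaussian.lintegral_mul_exp_finite_range_le (hm : m ≤ mΩ)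
    (h : IsCondSubgaussian P m Z R) (hZ : Measurable Z) {Θ : Ω → ℝ} (hΘ : Measurable[m] Θ)
    {V : Finset ℝ} (hV : ∀ ω, Θ ω ∈ V) {W : Ω → ℝ≥0∞} (hW : Measurable[m] W) :
    ∫⁻ ω, W ω * ENNReal.ofReal (Real.exp (Θ ω * Z ω - Θ ω ^ 2 * R ^ 2 / 2)) ∂P
      ≤ ∫⁻ ω, W ω ∂P := by
  have hWs : ∀ s : ℝ, Measurable[m] ((Θ ⁻¹' {s}).indicator W) := fun s =>
    hW.indicator (hΘ (measurableSet_singleton s))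
  have hsum : ∀ ω (c : ℝ → ℝ≥0∞), ∑ s ∈ V, (Θ ⁻¹' {s}).indicator W ω * c s
      = W ω * c (Θ ω) := by
    intro ω c
    rw [Finset.sum_eq_single (Θ ω)]
    · simp
    · intro s _ hs
      rw [Set.indicator_of_notMem, zero_mul]
      simpa using hs.symm
    · intro hω
      exact absurd (hV ω) hω
  calc ∫⁻ ω, W ω * ENNReal.ofReal (Real.exp (Θ ω * Z ω - Θ ω ^ 2 * R ^ 2 / 2)) ∂P
      = ∑ s ∈ V, ∫⁻ ω, (Θ ⁻¹' {s}).indicator W ω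
          * ENNReal.ofReal (Real.exp (s * Z ω - s ^ 2 * R ^ 2 / 2)) ∂P := by
        rw [← lintegral_finsetSum]
        · refine lintegral_congr fun ω => ?_
          exact (hsum ω fun s => ENNReal.ofReal (Real.exp (s * Z ω - s ^ 2 * R ^ 2 / 2))).symm
        · intro s _
          have := (hWs s).mono hm le_rfl
          fun_prop
    _ ≤ ∑ s ∈ V, ∫⁻ ω, (Θ ⁻¹' {s}).indicator W ω ∂P :=
        Finset.sum_le_sum fun s _ => h.lintegral_mul_exp_const_le hm hZ s (hWs s)
    _ = ∫⁻ ω, W ω ∂P := by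
        rw [← lintegral_finsetSum _ fun s _ => (hWs s).mono hm le_rfl]
        refine lintegral_congr fun ω => ?_
        simpa using hsum ω fun _ => 1

/-- Simple `m`-measurable approximations of `Θ`, then Fatou, which needs no domination. -/
theorem IsCondSubgaussian.lintegral_mul_exp_le (hm : m ≤ mΩ)
    (h : IsCondSubgaussian P m Z R) (hZ : Measurable Z) {Θ : Ω → ℝ} (hΘ : Measurable[m] Θ)
    {W : Ω → ℝ≥0∞} (hW : Measurable[m] W) :
    ∫⁻ ω, W ω * ENNReal.ofReal (Real.exp (Θ ω * Z ω - Θ ω ^ 2 * R ^ 2 / 2)) ∂P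
      ≤ ∫⁻ ω, W ω ∂P := by
  have hsm : StronglyMeasurable[m] Θ := hΘ.stronglyMeasurable
  have hWm := hW.mono hm le_rfl
  let F : ℕ → Ω → ℝ≥0∞ := fun n ω => W ω *
    ENNReal.ofReal (Real.exp (hsm.approx n ω * Z ω - hsm.approx n ω ^ 2 * R ^ 2 / 2))
  have hlim : ∀ ω, Filter.Tendsto (fun n => F n ω) Filter.atTop
      (nhds (W ω * ENNReal.ofReal (Real.exp (Θ ω * Z ω - Θ ω ^ 2 * R ^ 2 / 2)))) := by
    intro ω
    have hΘω := hsm.tendsto_approx ω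
    have hc : Continuous fun θ : ℝ =>
      ENNReal.ofReal (Real.exp (θ * Z ω - θ ^ 2 * R ^ 2 / 2)) :=
      ENNReal.continuous_ofReal.comp (by fun_prop)
    -- `W ω` may be `∞`; multiplication by it is still continuous at a nonzero limit.
    refine ENNReal.Tendsto.const_mul ((hc.tendsto _).comp hΘω) (Or.inl ?_)
    simp [Real.exp_pos]
  have hF : ∀ n, Measurable (F n) := fun n => by
    have : Measurable (hsm.approx n) := (@SimpleFunc.measurable Ω ℝ m _ (hsm.approx n)).mono hm le_rfl
    fun_prop
  calc ∫⁻ ω, W ω * ENNReal.ofReal (Real.exp (Θ ω * Z ω - Θ ω ^ 2 * R ^ 2 / 2)) ∂P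
      = ∫⁻ ω, Filter.liminf (fun n => F n ω) Filter.atTop ∂P :=
        lintegral_congr fun ω => (hlim ω).liminf_eq.symm
    _ ≤ Filter.liminf (fun n => ∫⁻ ω, F n ω ∂P) Filter.atTop := lintegral_liminf_le hF
    _ ≤ ∫⁻ ω, W ω ∂P := by
        refine Filter.liminf_le_of_le (by isBoundedDefault) fun b hb => ?_
        obtain ⟨n, hn⟩ := hb.exists
        exact hn.trans (h.lintegral_mul_exp_finite_range_le hm hZ
          (@SimpleFunc.measurable Ω ℝ m _ (hsm.approx n))
          (@SimpleFunc.mem_range_self Ω ℝ m (hsm.approx n)) hW)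

/-- The case where `η / R` is meaningless. Averaging `s = 1` and `s = -1` gives `𝔼 cosh Z ≤ 1`,
while `cosh` exceeds 1 away from 0. -/
theorem IsCondSubgaussian.ae_eq_zero (hm : m ≤ mΩ) (h : IsCondSubgaussian P m Z 0)
    (hZ : Measurable Z) : ∀ᵐ ω ∂P, Z ω = 0 := by
  have hle : ∀ s : ℝ, ∫⁻ ω, ENNReal.ofReal (Real.exp (s * Z ω)) ∂P ≤ 1 := by
    intro s
    simpa using h.setLIntegral_exp_le hm s (A := Set.univ) MeasurableSet.univ
  have hcosh : ∫⁻ ω, ENNReal.ofReal (Real.cosh (Z ω) - 1) ∂P = 0 := by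
    have h2 : ∫⁻ ω, (ENNReal.ofReal (Real.cosh (Z ω) - 1) + 1) ∂P ≤ 1 := by
      have heq : ∀ ω, ENNReal.ofReal (Real.cosh (Z ω) - 1) + 1
          = 2⁻¹ * (ENNReal.ofReal (Real.exp (1 * Z ω)) + ENNReal.ofReal (Real.exp (-1 * Z ω))) := by
        intro ω
        rw [← ENNReal.ofReal_one, ← ENNReal.ofReal_add (by linarith [Real.one_le_cosh (Z ω)])
          zero_le_one, ← ENNReal.ofReal_add (by positivity) (by positivity),
          show (2⁻¹ : ℝ≥0∞) = ENNReal.ofReal 2⁻¹ by rw [ENNReal.ofReal_inv_of_pos two_pos]; simp,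
          ← ENNReal.ofReal_mul (by positivity), Real.cosh_eq]
        congr 1
        ring_nf
      simp only [heq]
      rw [lintegral_const_mul _ (by fun_prop), lintegral_add_left (by fun_prop)]
      calc _ ≤ (2⁻¹ : ℝ≥0∞) * (1 + 1) := by gcongr <;> exact hle _
        _ = 1 := by rw [one_add_one_eq_two]; exact ENNReal.inv_mul_cancel (by simp) (by simp)
    rw [lintegral_add_right _ measurable_const, lintegral_const, measure_univ, one_mul] at h2
    by_contra hne
    have := ENNReal.lt_add_right (a := 1) (by simp) hne
    rw [add_comm] at this
    exact absurd h2 (not_le.2 this)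
  rw [lintegral_eq_zero_iff (by fun_prop)] at hcosh
  filter_upwards [hcosh] with ω hω
  by_contra hne
  have := Real.one_lt_cosh.2 hne
  simp at hω
  linarith

/-- Gaussian mixture of the exponentials `exp (θ e - θ² / 2)`, `θ = a + b z`. -/
theorem lintegral_exp_gaussianReal (a b e : ℝ) :
    ∫⁻ z, ENNReal.ofReal (Real.exp ((a + b * z) * e - (a + b * z) ^ 2 / 2)) ∂(gaussianReal 0 1)
      = ENNReal.ofReal (Real.exp ((b ^ 2 * e ^ 2 + 2 * a * e - a ^ 2) / (2 * (1 + b ^ 2)))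
          / √(1 + b ^ 2)) := by
  have hb : 0 < 1 + b ^ 2 := by positivity
  -- Completing the square: the integrand times the standard normal density is `C` times the density
  -- of `N(μ, v)`.
  set v : ℝ≥0 := ⟨(1 + b ^ 2)⁻¹, by positivity⟩ with hv
  have hvc : (v : ℝ) = (1 + b ^ 2)⁻¹ := rfl
  have hv0 : v ≠ 0 := by
    rw [← NNReal.coe_ne_zero, hvc]; positivity
  set μ : ℝ := b * (e - a) / (1 + b ^ 2) with hμ
  set C := Real.exp ((b ^ 2 * e ^ 2 + 2 * a * e - a ^ 2) / (2 * (1 + b ^ 2))) / √(1 + b ^ 2)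
  rw [gaussianReal_of_var_ne_zero 0 one_ne_zero,
    lintegral_withDensity_eq_lintegral_mul _ (measurable_gaussianPDF 0 1) (by fun_prop)]
  have hpt : ∀ z, (gaussianPDF 0 1 * fun z => ENNReal.ofReal
      (Real.exp ((a + b * z) * e - (a + b * z) ^ 2 / 2))) z
      = ENNReal.ofReal C * gaussianPDF μ v z := by
    intro z
    rw [Pi.mul_apply, gaussianPDF, gaussianPDF, ← ENNReal.ofReal_mul (gaussianPDFReal_nonneg _ _ _),
      ← ENNReal.ofReal_mul (by positivity)]
    congr 1
    simp only [gaussianPDFReal, C, hvc, NNReal.coe_one]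
    have h1 : √(2 * Real.pi * (1 + b ^ 2)⁻¹) = √(2 * Real.pi * 1) / √(1 + b ^ 2) := by
      rw [← Real.sqrt_div (by positivity), mul_one, div_eq_mul_inv]
    have h2 : Real.exp (-(z - 0) ^ 2 / (2 * 1)) * Real.exp ((a + b * z) * e - (a + b * z) ^ 2 / 2)
        = Real.exp ((b ^ 2 * e ^ 2 + 2 * a * e - a ^ 2) / (2 * (1 + b ^ 2)))
          * Real.exp (-(z - μ) ^ 2 / (2 * (1 + b ^ 2)⁻¹)) := by
      rw [← Real.exp_add, ← Real.exp_add, hμ]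
      congr 1
      field_simp
      ring
    rw [h1, mul_assoc, h2]
    field_simp
  simp only [hpt]
  rw [lintegral_const_mul _ (measurable_gaussianPDF μ v), lintegral_gaussianPDF_eq_one μ hv0,
    mul_one]

/-- One step of the self-normalized supermartingale: the Gaussian mixture with predictable mean `a`
and predictable standard deviation `b`. -/
theorem IsCondSubgaussian.lintegral_mul_mixture_le (hm : m ≤ mΩ)
    (h : IsCondSubgaussian P m Z R) (hR : 0 < R) (hZ : Measurable Z) {a b : Ω → ℝ}
    (ha : Measurable[m] a) (hb : Measurable[m] b) {W : Ω → ℝ≥0∞} (hW : Measurable[m] W) :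
    ∫⁻ ω, W ω * ENNReal.ofReal (Real.exp ((b ω ^ 2 * (Z ω / R) ^ 2 + 2 * a ω * (Z ω / R) - a ω ^ 2)
        / (2 * (1 + b ω ^ 2))) / √(1 + b ω ^ 2)) ∂P ≤ ∫⁻ ω, W ω ∂P := by
  have hWm := hW.mono hm le_rfl
  have ham := ha.mono hm le_rfl
  have hbm := hb.mono hm le_rfl
  simp only [← lintegral_exp_gaussianReal]
  calc _ = ∫⁻ ω, ∫⁻ z, W ω * ENNReal.ofReal (Real.exp ((a ω + b ω * z) * (Z ω / R)
            - (a ω + b ω * z) ^ 2 / 2)) ∂(gaussianReal 0 1) ∂P := by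
        refine lintegral_congr fun ω => ?_
        rw [lintegral_const_mul _ (by fun_prop)]
    _ = ∫⁻ z, ∫⁻ ω, W ω * ENNReal.ofReal (Real.exp ((a ω + b ω * z) * (Z ω / R)
            - (a ω + b ω * z) ^ 2 / 2)) ∂P ∂(gaussianReal 0 1) := by
        refine lintegral_lintegral_swap (Measurable.aemeasurable ?_)
        simp only [Function.uncurry_def]
        fun_prop
    _ ≤ ∫⁻ _, ∫⁻ ω, W ω ∂P ∂(gaussianReal 0 1) := by
        refine lintegral_mono fun z => ?_
        -- For fixed `z` the multiplier is predictable; dividing by `R` turns the penalty `θ² R² /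
        -- 2` into `(a + b z)² / 2`.
        have hΘ : Measurable[m] fun ω => (a ω + b ω * z) / R :=
          (ha.add (hb.mul_const z)).div_const R
        refine le_trans (le_of_eq (lintegral_congr fun ω => ?_))
          (h.lintegral_mul_exp_le hm hZ hΘ hW)
        congr 3
        field_simp
    _ = _ := by simp

end Noise

/-! ### Ville's maximal inequality. -/

section Ville

variable {Ω : Type*} {mΩ : MeasurableSpace Ω} {P : Measure Ω}

/-- Ville's maximal inequality, over finitely many steps, for processes with values in `[0, ∞]`. -/
theorem measure_exists_lt_le {M : ℕ → Ω → ℝ≥0∞} {ℱ : Filtration ℕ mΩ} {N : ℕ}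
    (hM : ∀ n ≤ N, Measurable[ℱ n] (M n))
    (hstep : ∀ n < N, ∀ S : Set Ω, MeasurableSet[ℱ n] S →
      ∫⁻ ω in S, M (n + 1) ω ∂P ≤ ∫⁻ ω in S, M n ω ∂P)
    (h0 : ∫⁻ ω, M 0 ω ∂P ≤ 1) (c : ℝ≥0∞) :
    c * P {ω | ∃ n ≤ N, c < M n ω} ≤ 1 := by
  let A : ℕ → Set Ω := fun n => {ω | ∃ i ≤ n, c < M i ω}
  have hA : ∀ n ≤ N, MeasurableSet[ℱ n] (A n) := by
    intro n hn
    have : A n = ⋃ i ∈ Finset.range (n + 1), {ω | c < M i ω} := by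
      ext ω; simp [A]
    rw [this]
    refine Finset.measurableSet_biUnion _ fun i hi => ?_
    have hi' : i ≤ n := by simpa [Nat.lt_succ_iff] using hi
    exact ℱ.mono hi' _ (measurableSet_lt measurable_const (hM i (hi'.trans hn)))
  -- Markov's inequality that keeps the part of the integral below the level `c`.
  have hsplit : ∀ n ≤ N, ∀ S : Set Ω, MeasurableSet[ℱ n] S →
      c * P (S ∩ {ω | c < M n ω}) + ∫⁻ ω in S ∩ {ω | c < M n ω}ᶜ, M n ω ∂P
        ≤ ∫⁻ ω in S, M n ω ∂P := by
    intro n hn S hS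
    have hms : MeasurableSet {ω | c < M n ω} :=
      ℱ.le n _ (measurableSet_lt measurable_const (hM n hn))
    rw [← lintegral_inter_add_sdiff (μ := P) (M n) S hms, Set.sdiff_eq]
    gcongr
    rw [← setLIntegral_const]
    exact setLIntegral_mono' ((ℱ.le n _ hS).inter hms) fun ω hω => hω.2.le
  -- The invariant is the expectation of the process replaced by `c` from its first crossing
  -- onwards.
  have key : ∀ n ≤ N, c * P (A n) + ∫⁻ ω in (A n)ᶜ, M n ω ∂P ≤ 1 := by
    intro n
    induction n with
    | zero =>
      intro hn
      have := hsplit 0 hn Set.univ MeasurableSet.univ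
      simp only [Set.univ_inter, Measure.restrict_univ] at this
      have hA0 : A 0 = {ω | c < M 0 ω} := by ext; simp [A]
      rw [hA0]
      exact this.trans h0
    | succ n ih =>
      intro hn
      have hn' : n ≤ N := by omega
      have hAn := hA n hn'
      have hunion : A (n + 1) = A n ∪ ((A n)ᶜ ∩ {ω | c < M (n + 1) ω}) := by
        ext ω
        constructor
        · rintro ⟨i, hi, hω⟩
          by_cases hAω : ω ∈ A n
          · exact Or.inl hAω
          · rcases Nat.lt_or_ge n i with hlt | hge
            · obtain rfl : i = n + 1 := by omega
              exact Or.inr ⟨hAω, hω⟩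
            · exact absurd ⟨i, hge, hω⟩ hAω
        · rintro (⟨i, hi, hω⟩ | ⟨-, hω⟩)
          · exact ⟨i, by omega, hω⟩
          · exact ⟨n + 1, le_rfl, hω⟩
      have hcompl : (A (n + 1))ᶜ = (A n)ᶜ ∩ {ω | c < M (n + 1) ω}ᶜ := by
        rw [hunion]
        ext ω
        simp only [Set.mem_compl_iff, Set.mem_union, Set.mem_inter_iff]
        tauto
      calc c * P (A (n + 1)) + ∫⁻ ω in (A (n + 1))ᶜ, M (n + 1) ω ∂P
          ≤ c * P (A n) + (c * P ((A n)ᶜ ∩ {ω | c < M (n + 1) ω})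
              + ∫⁻ ω in (A n)ᶜ ∩ {ω | c < M (n + 1) ω}ᶜ, M (n + 1) ω ∂P) := by
            rw [hcompl, hunion, ← add_assoc, ← mul_add]
            gcongr
            exact measure_union_le _ _
        _ ≤ c * P (A n) + ∫⁻ ω in (A n)ᶜ, M (n + 1) ω ∂P := by
            gcongr
            exact hsplit (n + 1) hn _ (ℱ.mono (Nat.le_succ n) _ hAn.compl)
        _ ≤ c * P (A n) + ∫⁻ ω in (A n)ᶜ, M n ω ∂P := by
            exact add_le_add le_rfl (hstep n (by omega) _ hAn.compl)
        _ ≤ 1 := ih hn'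
  exact le_self_add.trans (key N le_rfl)

end Ville

end AdveRS

namespace AdveRS

/-! ### Measurability of the regression quantities. -/

section MeasurablePosterior

open Matrix

variable {Ω X : Type*} [MeasurableSpace Ω] [MeasurableSpace X] {k : X → X → ℝ} {lam : ℝ} {n : ℕ}

theorem measurable_matrix_det {M : Ω → Matrix (Fin n) (Fin n) ℝ}
    (hM : ∀ i j, Measurable fun ω => M ω i j) : Measurable fun ω => (M ω).det := by
  simp only [det_apply']
  fun_prop

/-- The adjugate formula, which also covers singular matrices, where the inverse is `0`. -/
theorem measurable_matrix_inv_apply {M : Ω → Matrix (Fin n) (Fin n) ℝ}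
    (hM : ∀ i j, Measurable fun ω => M ω i j) (i j : Fin n) :
    Measurable fun ω => (M ω)⁻¹ i j := by
  simp only [inv_def, Matrix.smul_apply, adjugate_apply, Ring.inverse_eq_inv', smul_eq_mul]
  refine (measurable_matrix_det hM).inv.mul (measurable_matrix_det fun a b => ?_)
  simp only [updateRow_apply]
  split_ifs
  · exact measurable_const
  · exact hM a b

theorem measurable_kernel_comp (hk : Measurable (Function.uncurry k)) {a b : Ω → X}
    (ha : Measurable a) (hb : Measurable b) : Measurable fun ω => k (a ω) (b ω) :=
  hk.comp (ha.prodMk hb)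

theorem measurable_regKernelMatrix_inv (hk : Measurable (Function.uncurry k)) {A : Ω → Fin n → X}
    (hA : ∀ i, Measurable fun ω => A ω i) (i j : Fin n) :
    Measurable fun ω => (regKernelMatrix k lam (A ω))⁻¹ i j := by
  refine measurable_matrix_inv_apply (fun i j => ?_) i j
  exact (measurable_kernel_comp hk (hA i) (hA j)).add measurable_const

theorem measurable_dotProduct_inv_mulVec (hk : Measurable (Function.uncurry k))
    {A : Ω → Fin n → X} (hA : ∀ i, Measurable fun ω => A ω i) {u v : Ω → Fin n → ℝ}
    (hu : ∀ i, Measurable fun ω => u ω i) (hv : ∀ i, Measurable fun ω => v ω i) :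
    Measurable fun ω => u ω ⬝ᵥ (regKernelMatrix k lam (A ω))⁻¹ *ᵥ v ω := by
  have := measurable_regKernelMatrix_inv (lam := lam) hk hA
  have hmul : ∀ i, Measurable fun ω => ((regKernelMatrix k lam (A ω))⁻¹ *ᵥ v ω) i := fun i =>
    Finset.measurable_fun_sum Finset.univ fun j _ => (this i j).fun_mul (hv j)
  exact Finset.measurable_fun_sum Finset.univ fun i _ => (hu i).fun_mul (hmul i)

theorem measurable_posteriorMean (hk : Measurable (Function.uncurry k))
    {A : Ω → Fin n → X} (hA : ∀ i, Measurable fun ω => A ω i) {e : Ω → Fin n → ℝ}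
    (he : ∀ i, Measurable fun ω => e ω i) {a : Ω → X} (ha : Measurable a) :
    Measurable fun ω => posteriorMean k lam (A ω) (e ω) (a ω) :=
  measurable_dotProduct_inv_mulVec hk hA (fun i => measurable_kernel_comp hk (hA i) ha) he

theorem measurable_posteriorCov (hk : Measurable (Function.uncurry k))
    {A : Ω → Fin n → X} (hA : ∀ i, Measurable fun ω => A ω i) {a : Ω → X} (ha : Measurable a) :
    Measurable fun ω => posteriorCov k lam (A ω) (a ω) (a ω) :=
  (measurable_kernel_comp hk ha ha).sub (measurable_dotProduct_inv_mulVec hk hA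
    (fun i => measurable_kernel_comp hk (hA i) ha) (fun i => measurable_kernel_comp hk (hA i) ha))

theorem measurable_noiseEnergy (hk : Measurable (Function.uncurry k))
    {A : Ω → Fin n → X} (hA : ∀ i, Measurable fun ω => A ω i) {e : Ω → Fin n → ℝ}
    (he : ∀ i, Measurable fun ω => e ω i) :
    Measurable fun ω => noiseEnergy k lam (A ω) (e ω) := by
  refine Measurable.sub ?_ ((measurable_dotProduct_inv_mulVec hk hA he he).const_mul lam)
  simp only [dotProduct]
  fun_prop

theorem measurable_logDet (hk : Measurable (Function.uncurry k))
    {A : Ω → Fin n → X} (hA : ∀ i, Measurable fun ω => A ω i) :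
    Measurable fun ω => logDet k lam (A ω) := by
  refine Real.measurable_log.comp (measurable_matrix_det fun i j => ?_)
  exact measurable_const.add ((measurable_kernel_comp hk (hA i) (hA j)).const_mul _)

end MeasurablePosterior

/-! ### The self-normalized supermartingale. -/

section SelfNormalized

open scoped RealInnerProductSpace

variable {X : Type*} {H : Type*} [NormedAddCommGroup H] [InnerProductSpace ℝ H]
  {k : X → X → ℝ} {φ : X → H} {lam R : ℝ}

/-- The self-normalized process `exp (eᵀ K (K + λ I)⁻¹ e / (2 R²)) / √det (I + λ⁻¹ K)`. -/
noncomputable def selfNormalizedProcess (k : X → X → ℝ) (lam R : ℝ) (x : ℕ → X) (e : ℕ → ℝ)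
    (n : ℕ) : ℝ :=
  Real.exp (noiseEnergy k lam (firstTerms x n) (firstTerms e n) / (2 * R ^ 2)
    - logDet k lam (firstTerms x n) / 2)

theorem selfNormalizedProcess_pos {x : ℕ → X} {e : ℕ → ℝ} {n : ℕ} :
    0 < selfNormalizedProcess k lam R x e n :=
  Real.exp_pos _

theorem selfNormalizedProcess_zero (x : ℕ → X) (e : ℕ → ℝ) :
    selfNormalizedProcess k lam R x e 0 = 1 := by
  simp [selfNormalizedProcess, logDet_zero, noiseEnergy]

/-- The factor is the closed form of the Gaussian mixture with mean `a` and standard deviation `b`: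
`1 + b²` is the determinant ratio, and the exponent is the energy increment over `2R²`. -/
theorem selfNormalizedProcess_succ (hk : ∀ x x', k x x' = ⟪φ x, φ x'⟫) (hlam : 0 < lam)
    (hR : 0 < R) (x : ℕ → X) (e : ℕ → ℝ) (n : ℕ) {a b : ℝ}
    (ha : a = posteriorMean k lam (firstTerms x n) (firstTerms e n) (x (n + 1)) / R)
    (hb : b = √(posteriorCov k lam (firstTerms x n) (x (n + 1)) (x (n + 1)) / lam)) :
    selfNormalizedProcess k lam R x e (n + 1) = selfNormalizedProcess k lam R x e n
      * (Real.exp ((b ^ 2 * (e (n + 1) / R) ^ 2 + 2 * a * (e (n + 1) / R) - a ^ 2)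
        / (2 * (1 + b ^ 2))) / √(1 + b ^ 2)) := by
  have hs := posteriorCov_self_nonneg hk hlam (firstTerms x n) (x (n + 1))
  have hb2 : b ^ 2 = posteriorCov k lam (firstTerms x n) (x (n + 1)) (x (n + 1)) / lam := by
    rw [hb, Real.sq_sqrt (by positivity)]
  have h1 : noiseEnergy k lam (firstTerms x (n + 1)) (firstTerms e (n + 1))
      = noiseEnergy k lam (firstTerms x n) (firstTerms e n) + (e (n + 1) ^ 2 - lam * (e (n + 1)
          - posteriorMean k lam (firstTerms x n) (firstTerms e n) (x (n + 1))) ^ 2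
        / (posteriorCov k lam (firstTerms x n) (x (n + 1)) (x (n + 1)) + lam)) :=
    noiseEnergy_succ hk hlam (firstTerms x (n + 1)) (firstTerms e (n + 1))
  have h2 : logDet k lam (firstTerms x (n + 1)) = logDet k lam (firstTerms x n)
      + Real.log (1 + posteriorCov k lam (firstTerms x n) (x (n + 1)) (x (n + 1)) / lam) :=
    logDet_succ hk hlam (firstTerms x (n + 1))
  have hpos : 0 < 1 + b ^ 2 := by positivity
  have h3 : √(1 + b ^ 2) = Real.exp (Real.log (1 + b ^ 2) / 2) := by
    rw [Real.exp_half, Real.exp_log hpos]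
  rw [selfNormalizedProcess, selfNormalizedProcess, h1, h2, h3, ← Real.exp_sub, ← Real.exp_add,
    hb2, ha]
  congr 1
  set s := posteriorCov k lam (firstTerms x n) (x (n + 1)) (x (n + 1))
  have : s + lam ≠ 0 := by positivity
  have : lam + s ≠ 0 := by positivity
  field_simp
  ring

variable [MeasurableSpace X] {Ω : Type*} {mΩ : MeasurableSpace Ω} {P : Measure Ω}
  [IsProbabilityMeasure P] {T : ℕ} {x : ℕ → Ω → X} {η : ℕ → Ω → ℝ} {ℱ : Filtration ℕ mΩ}

theorem measurable_firstTerms {Y : Type*} [MeasurableSpace Y] {z : ℕ → Ω → Y}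
    (hz : ∀ t ∈ Finset.Icc 1 T, Measurable[ℱ t] (z t)) {n : ℕ} (hn : n ≤ T) (i : Fin n) :
    Measurable[ℱ n] fun ω => firstTerms (fun t => z t ω) n i :=
  (hz (i + 1) (by simp; omega)).mono (ℱ.mono (by omega)) le_rfl

/-- The self-normalized deviation inequality in a reproducing kernel Hilbert space, for `R > 0`. -/
theorem measure_exists_noiseEnergy_gt_le (hk : ∀ x x', k x x' = ⟪φ x, φ x'⟫) (hlam : 0 < lam)
    (hk_meas : Measurable (Function.uncurry k)) (hR : 0 < R) {ζ : ℝ} (hζ : 0 < ζ)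
    (hx : ∀ t ∈ Finset.Icc 1 T, Measurable[ℱ (t - 1)] (x t))
    (hη : ∀ t ∈ Finset.Icc 1 T, Measurable[ℱ t] (η t))
    (hη_sub : ∀ t ∈ Finset.Icc 1 T, IsCondSubgaussian P (ℱ (t - 1)) (η t) R) :
    P {ω | ∃ n ≤ T, R ^ 2 * (logDet k lam (firstTerms (fun t => x t ω) n) + 2 * Real.log (1 / ζ))
      < noiseEnergy k lam (firstTerms (fun t => x t ω) n) (firstTerms (fun t => η t ω) n)}
      ≤ ENNReal.ofReal ζ := by
  have hx' : ∀ t ∈ Finset.Icc 1 T, Measurable[ℱ t] (x t) := fun t ht =>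
    (hx t ht).mono (ℱ.mono (Nat.sub_le t 1)) le_rfl
  let M : ℕ → Ω → ℝ≥0∞ := fun n ω =>
    ENNReal.ofReal (selfNormalizedProcess k lam R (fun t => x t ω) (fun t => η t ω) n)
  have hM : ∀ n ≤ T, Measurable[ℱ n] (M n) := by
    intro n hn
    have h1 := @measurable_noiseEnergy Ω X (ℱ n) _ k lam n hk_meas _
      (measurable_firstTerms hx' hn) _ (measurable_firstTerms hη hn)
    have h2 := @measurable_logDet Ω X (ℱ n) _ k lam n hk_meas _ (measurable_firstTerms hx' hn)
    exact ENNReal.measurable_ofReal.comp (Real.measurable_exp.comp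
      ((h1.div_const _).sub (h2.div_const _)))
  have hstep : ∀ n < T, ∀ S : Set Ω, MeasurableSet[ℱ n] S →
      ∫⁻ ω in S, M (n + 1) ω ∂P ≤ ∫⁻ ω in S, M n ω ∂P := by
    intro n hn S hS
    have hmem : n + 1 ∈ Finset.Icc 1 T := by simp; omega
    have hxn : Measurable[ℱ n] (x (n + 1)) := hx (n + 1) hmem
    have hsub : IsCondSubgaussian P (ℱ n) (η (n + 1)) R := hη_sub (n + 1) hmem
    have ha := (@measurable_posteriorMean Ω X (ℱ n) _ k lam n hk_meas _
      (measurable_firstTerms hx' hn.le) _ (measurable_firstTerms hη hn.le) _ hxn).div_const R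
    have hb := ((@measurable_posteriorCov Ω X (ℱ n) _ k lam n hk_meas _
      (measurable_firstTerms hx' hn.le) _ hxn).div_const lam).sqrt
    -- The restriction to `S` joins the predictable weight, `W = 1_S M_n`.
    rw [← lintegral_indicator (ℱ.le n _ hS), ← lintegral_indicator (ℱ.le n _ hS)]
    refine le_trans (le_of_eq (lintegral_congr fun ω => ?_))
      (hsub.lintegral_mul_mixture_le (ℱ.le n) hR ((hη (n + 1) hmem).mono (ℱ.le _) le_rfl) ha hb
        ((hM n hn.le).indicator hS))
    by_cases hω : ω ∈ S
    · rw [Set.indicator_of_mem hω, Set.indicator_of_mem hω]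
      change ENNReal.ofReal _
        = ENNReal.ofReal (selfNormalizedProcess k lam R (fun t => x t ω) (fun t => η t ω) n) * _
      rw [← ENNReal.ofReal_mul selfNormalizedProcess_pos.le, ← selfNormalizedProcess_succ hk hlam hR (fun t => x t ω) (fun t => η t ω) n rfl rfl]
    · rw [Set.indicator_of_notMem hω, Set.indicator_of_notMem hω, zero_mul]
  have h0 : ∫⁻ ω, M 0 ω ∂P ≤ 1 := by
    simp [M, selfNormalizedProcess_zero]
  have hville := measure_exists_lt_le hM hstep h0 (ENNReal.ofReal (1 / ζ))
  have hset : {ω | ∃ n ≤ T, R ^ 2 * (logDet k lam (firstTerms (fun t => x t ω) n)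
        + 2 * Real.log (1 / ζ))
      < noiseEnergy k lam (firstTerms (fun t => x t ω) n) (firstTerms (fun t => η t ω) n)}
      = {ω | ∃ n ≤ T, ENNReal.ofReal (1 / ζ) < M n ω} := by
    ext ω
    refine exists_congr fun n => and_congr_right fun _ => ?_
    change _ ↔ ENNReal.ofReal (1 / ζ) < ENNReal.ofReal (Real.exp _)
    rw [ENNReal.ofReal_lt_ofReal_iff (Real.exp_pos _),
      ← Real.log_lt_iff_lt_exp (by positivity), lt_sub_iff_add_lt, lt_div_iff₀ (by positivity)]
    ring_nf
  rw [hset]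
  have hmul := mul_le_mul_right hville (ENNReal.ofReal ζ)
  rwa [← mul_assoc, ← ENNReal.ofReal_mul hζ.le, mul_one_div_cancel hζ.ne', ENNReal.ofReal_one,
    one_mul, mul_one] at hmul

/-- The self-normalized deviation inequality in a reproducing kernel Hilbert space. -/
theorem le_measure_noiseEnergy_le (hk : ∀ x x', k x x' = ⟪φ x, φ x'⟫) (hlam : 0 < lam)
    (hk_meas : Measurable (Function.uncurry k)) (hR : 0 ≤ R) {ζ : ℝ} (hζ : 0 < ζ)
    (hx : ∀ t ∈ Finset.Icc 1 T, Measurable[ℱ (t - 1)] (x t))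
    (hη : ∀ t ∈ Finset.Icc 1 T, Measurable[ℱ t] (η t))
    (hη_sub : ∀ t ∈ Finset.Icc 1 T, IsCondSubgaussian P (ℱ (t - 1)) (η t) R) :
    ENNReal.ofReal (1 - ζ) ≤ P {ω | ∀ n ≤ T,
      noiseEnergy k lam (firstTerms (fun t => x t ω) n) (firstTerms (fun t => η t ω) n)
        ≤ R ^ 2 * (logDet k lam (firstTerms (fun t => x t ω) n) + 2 * Real.log (1 / ζ))} := by
  set G := {ω | ∀ n ≤ T,
      noiseEnergy k lam (firstTerms (fun t => x t ω) n) (firstTerms (fun t => η t ω) n)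
        ≤ R ^ 2 * (logDet k lam (firstTerms (fun t => x t ω) n) + 2 * Real.log (1 / ζ))} with hG
  have hcompl : P Gᶜ ≤ ENNReal.ofReal ζ := by
    rcases hR.eq_or_lt with rfl | hR
    · have h0 : ∀ᵐ ω ∂P, ∀ t ∈ Finset.Icc 1 T, η t ω = 0 := by
        rw [Filter.eventually_all_finset]
        exact fun t ht => (hη_sub t ht).ae_eq_zero (ℱ.le _) ((hη t ht).mono (ℱ.le _) le_rfl)
      have : P Gᶜ = 0 := by
        rw [← mem_ae_iff]
        filter_upwards [h0] with ω hω n hn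
        have : firstTerms (fun t => η t ω) n = 0 := by
          ext i
          exact hω (i + 1) (by simp; omega)
        simp [this, noiseEnergy]
      simp [this]
    · have : Gᶜ = {ω | ∃ n ≤ T, R ^ 2 * (logDet k lam (firstTerms (fun t => x t ω) n)
            + 2 * Real.log (1 / ζ))
          < noiseEnergy k lam (firstTerms (fun t => x t ω) n) (firstTerms (fun t => η t ω) n)} := by
        ext ω; simp [hG]
      rw [this]
      exact measure_exists_noiseEnergy_gt_le hk hlam hk_meas hR hζ hx hη hη_sub
  -- Subadditivity alone, so `G` need not be shown measurable.
  have h1 : (1 : ℝ≥0∞) ≤ P G + P Gᶜ := by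
    rw [← measure_univ (μ := P), ← Set.union_compl_self G]
    exact measure_union_le _ _
  rw [ENNReal.ofReal_sub _ hζ.le, ENNReal.ofReal_one, tsub_le_iff_right]
  exact h1.trans (by gcongr)

end SelfNormalized

end AdveRS

namespace AdveRS

/-! ### Order and continuity properties of the fragility. -/

section Fragility

variable {E : Type*} [AddCommGroup E] {𝒳 : Set E} {d : 𝒳 → 𝒳 → ℝ} {f g : 𝒳 → ℝ} {τ p : ℝ}

theorem IsFeasible.le {x : 𝒳} {κ : ℝ≥0} (h : IsFeasible d g τ p x κ) (x' : 𝒳) :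
    τ - (κ * d x x') ^ p ≤ g x' := by
  have hmem : (x' : E) - x ∈ ambiguityBall d ⊤ x := ⟨x', rfl, le_top⟩
  have hx' : perturb x ⟨(x' : E) - x, hmem⟩ = x' := by
    ext
    simp [perturb]
  simpa only [hx'] using h ⟨(x' : E) - x, hmem⟩

theorem pFragility_anti (hfg : ∀ z, f z ≤ g z) (x : 𝒳) :
    pFragility d g τ p x ≤ pFragility d f τ p x :=
  iInf_mono fun _ => iInf_mono' fun h => ⟨fun δ => (h δ).trans (hfg _), le_rfl⟩

/-- The infimum is attained: every `κ' > κ` dominates a feasible value, and the constraint is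
continuous as `κ' ↓ κ`. -/
theorem sub_rpow_le_of_pFragility_le (hd : ∀ z z', 0 ≤ d z z') (hp : 0 < p) {x : 𝒳} {κ : ℝ≥0}
    (h : pFragility d g τ p x ≤ κ) (x' : 𝒳) : τ - (κ * d x x') ^ p ≤ g x' := by
  have hlt : ∀ κ' ∈ Set.Ioi κ, τ - ((κ' : ℝ) * d x x') ^ p ≤ g x' := by
    intro κ' hκ'
    have h1 : pFragility d g τ p x < κ' := h.trans_lt (by exact_mod_cast hκ')
    simp only [pFragility, iInf_lt_iff] at h1
    obtain ⟨κ'', hfeas, hlt⟩ := h1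
    have hle : (κ'' : ℝ) ≤ κ' := by exact_mod_cast hlt.le
    refine le_trans ?_ (hfeas.le x')
    have := hd x x'
    gcongr
  have hcont : Continuous fun κ' : ℝ≥0 => τ - ((κ' : ℝ) * d x x') ^ p :=
    continuous_const.sub ((NNReal.continuous_coe.mul continuous_const).rpow_const
      fun _ => Or.inr hp.le)
  exact le_of_tendsto ((hcont.tendsto κ).mono_left nhdsWithin_le_nhds)
    (Filter.eventually_of_mem self_mem_nhdsWithin hlt)

end Fragility

/-! ### From confidence bounds to regret. -/

section Regret

open scoped RealInnerProductSpace

variable {X : Type*} {H : Type*} [NormedAddCommGroup H] [InnerProductSpace ℝ H]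
  {k : X → X → ℝ} {φ : X → H} {lam B R ζ : ℝ}

theorem kernelMetric_eq_norm_sub (hk : ∀ x x', k x x' = ⟪φ x, φ x'⟫) (x x' : X) :
    kernelMetric k x x' = ‖φ x - φ x'‖ := by
  rw [kernelMetric, hk, hk, hk, real_inner_self_eq_norm_sq, real_inner_self_eq_norm_sq,
    ← norm_sub_sq_real, Real.sqrt_sq (norm_nonneg _)]

/-- `F` is `‖f‖`-Lipschitz for the kernel metric, so `‖f‖` is feasible wherever `τ ≤ F`. -/
theorem minPFragility_one_ne_top {E : Type*} [AddCommGroup E] {𝒳 : Set E} {k : 𝒳 → 𝒳 → ℝ}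
    {φ : 𝒳 → H} (hk : ∀ x x', k x x' = ⟪φ x, φ x'⟫) {τ : ℝ} {f : H} {F : 𝒳 → ℝ}
    (hF : ∀ x, F x = ⟪φ x, f⟫) (hτ : ∃ x, τ ≤ F x) :
    minPFragility (kernelMetric k) F τ 1 ≠ ⊤ := by
  obtain ⟨x, hx⟩ := hτ
  have hfeas : IsFeasible (kernelMetric k) F τ 1 x ‖f‖₊ := by
    intro δ
    have h := (le_abs_self _).trans (abs_real_inner_le_norm (φ x - φ (perturb x δ)) f)
    rw [inner_sub_left, ← hF, ← hF] at h
    rw [Real.rpow_one, kernelMetric_eq_norm_sub hk, coe_nnnorm, mul_comm]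
    linarith
  exact ne_top_of_le_ne_top ENNReal.coe_ne_top ((iInf_le _ x).trans (iInf₂_le _ hfeas))

/-- For `λ ≤ 1` the maximum is `1`, and the determinant is that of the information gain. -/
theorem explorationParam_eq (hlam1 : lam ≤ 1) {n : ℕ} (A : Fin n → X) :
    explorationParam k lam B R ζ A
      = B + R / √lam * √(logDet k lam A + 2 * Real.log (1 / ζ)) := by
  rw [explorationParam, max_eq_left hlam1, one_div lam, one_smul, logDet, add_comm (1 : Matrix _ _ ℝ)]

theorem beta_mono (hk : ∀ x x', k x x' = ⟪φ x, φ x'⟫) (hlam : 0 < lam) (hlam1 : lam ≤ 1)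
    (hR : 0 ≤ R) (x : ℕ → X) : Monotone (beta k lam B R ζ x) := by
  intro s t hst
  rw [beta, beta, explorationParam_eq hlam1, explorationParam_eq hlam1]
  have := logDet_firstTerms_mono hk hlam x (Nat.sub_le_sub_right hst 1)
  dsimp only at this
  gcongr

theorem beta_nonneg (hlam1 : lam ≤ 1) (hB : 0 ≤ B) (hR : 0 ≤ R) (x : ℕ → X)
    (t : ℕ) : 0 ≤ beta k lam B R ζ x t := by
  rw [beta, explorationParam_eq hlam1]
  positivity

/-- The confidence bounds that a bound on the noise energy implies. -/
theorem abs_sub_posteriorMean_le_beta (hk : ∀ x x', k x x' = ⟪φ x, φ x'⟫) (hlam : 0 < lam)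
    (hlam1 : lam ≤ 1) (hR : 0 ≤ R) {f : H} (hB : ‖f‖ ≤ B) {F : X → ℝ} (hF : ∀ x, F x = ⟪φ x, f⟫)
    {x : ℕ → X} {y η : ℕ → ℝ} {t : ℕ} (hy : ∀ s ∈ Finset.Icc 1 (t - 1), y s = F (x s) + η s)
    (hη : noiseEnergy k lam (firstTerms x (t - 1)) (firstTerms η (t - 1))
      ≤ R ^ 2 * (logDet k lam (firstTerms x (t - 1)) + 2 * Real.log (1 / ζ))) (z : X) :
    |F z - posteriorMean k lam (firstTerms x (t - 1)) (firstTerms y (t - 1)) z|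
      ≤ beta k lam B R ζ x t * posteriorStd k lam (firstTerms x (t - 1)) z := by
  have hyn : firstTerms y (t - 1) = fun i => ⟪φ (firstTerms x (t - 1) i), f⟫
      + firstTerms η (t - 1) i := by
    ext i
    rw [← hF]
    exact hy (i + 1) (Finset.mem_Icc.2 ⟨by omega, by omega⟩)
  rw [hyn, hF]
  refine (abs_sub_posteriorMean_le hk hlam _ f _ z).trans ?_
  refine mul_le_mul_of_nonneg_right ?_ (Real.sqrt_nonneg _)
  rw [beta, explorationParam_eq hlam1]
  refine add_le_add hB ?_
  refine (Real.sqrt_le_sqrt (div_le_div_of_nonneg_right hη hlam.le)).trans_eq ?_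
  rw [Real.sqrt_div' _ hlam.le, Real.sqrt_mul (sq_nonneg R), Real.sqrt_sq hR]
  ring

/-- The sum of the posterior standard deviations at the sampled points. -/
theorem sum_posteriorStd_le (hk : ∀ x x', k x x' = ⟪φ x, φ x'⟫) (hlam : 0 < lam)
    (hlam1 : lam ≤ 1) (hk1 : ∀ x, k x x ≤ 1) (x : ℕ → X) (T : ℕ) :
    ∑ t ∈ Finset.Icc 1 T, posteriorStd k lam (firstTerms x (t - 1)) (x t)
      ≤ 2 * √(T * maxInfoGain k lam T) := by
  have hreindex : ∑ t ∈ Finset.Icc 1 T, posteriorStd k lam (firstTerms x (t - 1)) (x t)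
      = ∑ t ∈ Finset.range T, posteriorStd k lam (firstTerms x t) (x (t + 1)) := by
    rw [← Finset.Ico_add_one_right_eq_Icc, Finset.sum_Ico_eq_sum_range]
    exact Finset.sum_congr rfl fun t _ => by rw [add_comm 1 t]; rfl
  -- One factor 2 comes from `s ≤ 2 log (1 + s)`, the other from the `1/2` in the information gain.
  have hsq : ∑ t ∈ Finset.range T, posteriorStd k lam (firstTerms x t) (x (t + 1)) ^ 2
      ≤ 4 * maxInfoGain k lam T := by
    have h1 := sum_posteriorCov_le hk hlam hlam1 hk1 x T
    have h2 := logDet_le_maxInfoGain hk hlam hk1 (firstTerms x T)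
    simp only [posteriorStd, Real.sq_sqrt (posteriorCov_self_nonneg hk hlam _ _)]
    linarith
  rw [hreindex, show (2 : ℝ) = √4 by rw [show (4 : ℝ) = 2 ^ 2 by norm_num]; simp,
    ← Real.sqrt_mul (by norm_num)]
  apply Real.le_sqrt_of_sq_le
  refine sq_sum_le_card_mul_sum_sq.trans ?_
  rw [Finset.card_range, mul_left_comm]
  gcongr

/-- The regret bound for a single run along which the noise energy is controlled. -/
theorem IsAdveRSGRun.rsgRegret_le {E : Type*} [AddCommGroup E] {𝒳 : Set E} {k : 𝒳 → 𝒳 → ℝ}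
    {φ : 𝒳 → H} (hk : ∀ x x', k x x' = ⟪φ x, φ x'⟫) (hlam : 0 < lam)
    (hlam1 : lam ≤ 1) (hk1 : ∀ x, k x x ≤ 1) (hR : 0 ≤ R) {f : H} (hB : ‖f‖ ≤ B) {F : 𝒳 → ℝ}
    (hF : ∀ x, F x = ⟪φ x, f⟫) {τ p : ℝ} (hp : 0 < p)
    (hκ : minPFragility (kernelMetric k) F τ p ≠ ⊤)
    {ε : ℕ → ℝ} {T : ℕ} {xSel : ℕ → 𝒳} {δ : ℕ → E} {x : ℕ → 𝒳} {y η : ℕ → ℝ}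
    (hrun : IsAdveRSGRun k lam B R ζ τ p F ε T xSel δ x y η)
    (hη : ∀ n ≤ T, noiseEnergy k lam (firstTerms x n) (firstTerms η n)
      ≤ R ^ 2 * (logDet k lam (firstTerms x n) + 2 * Real.log (1 / ζ))) :
    rsgRegret (kernelMetric k) F τ p ε x T
      ≤ 4 * beta k lam B R ζ x T * √(T * maxInfoGain k lam T) := by
  have hβ : 0 ≤ beta k lam B R ζ x T :=
    beta_nonneg hlam1 ((norm_nonneg f).trans hB) hR x T
  have hd : ∀ z z', 0 ≤ kernelMetric k z z' := fun _ _ => Real.sqrt_nonneg _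
  -- Finiteness matters here: `⊤` would be sent to `0`.
  set κ := (minPFragility (kernelMetric k) F τ p).toNNReal with hκdef
  have hκcoe : (κ : ℝ≥0∞) = minPFragility (kernelMetric k) F τ p := ENNReal.coe_toNNReal hκ
  have hterm : ∀ t ∈ Finset.Icc 1 T,
      max (τ - ((minPFragility (kernelMetric k) F τ p).toReal * ε t) ^ p - F (x t)) 0
        ≤ 2 * beta k lam B R ζ x T * posteriorStd k lam (firstTerms x (t - 1)) (x t) := by
    intro t ht
    have ht' := Finset.mem_Icc.1 ht
    have hconf := abs_sub_posteriorMean_le_beta (ζ := ζ) hk hlam hlam1 hR hB hF (x := x) (y := y)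
      (η := η) (t := t) (fun s hs => hrun.observed s (by simp at hs ⊢; omega))
      (hη (t - 1) (by omega))
    have hucb : ∀ z, F z ≤ ucb k lam B R ζ x y t z := fun z => by
      have := (abs_le.1 (hconf z)).2
      rw [ucb]; linarith
    -- Optimism: raising the function lowers every fragility, and `xSel t` minimizes the lowered
    -- one.
    have hsel : pFragility (kernelMetric k) (ucb k lam B R ζ x y t) τ p (xSel t) ≤ κ := by
      rw [hκcoe]
      exact le_iInf fun z => (hrun.selected t ht z).trans (pFragility_anti hucb z)
    have hdist : kernelMetric k (xSel t) (x t) ≤ ε t := by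
      obtain ⟨x', hx', hle⟩ := hrun.perturbation t ht
      have : x t = x' := by
        ext
        rw [hrun.sampled t ht, hx', add_sub_cancel]
      rw [this]
      exact EReal.coe_le_coe_iff.1 hle
    -- The fragility constraint covers all perturbations, so it applies at the adversary's point.
    have h1 := sub_rpow_le_of_pFragility_le hd hp hsel (x t)
    have h2 : ((κ : ℝ) * kernelMetric k (xSel t) (x t)) ^ p ≤ ((κ : ℝ) * ε t) ^ p := by
      have := hd (xSel t) (x t)
      gcongr
    have h3 := (abs_le.1 (hconf (x t))).1
    have hσ : 0 ≤ posteriorStd k lam (firstTerms x (t - 1)) (x t) := Real.sqrt_nonneg _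
    have h4 := mul_le_mul_of_nonneg_right (beta_mono (B := B) (ζ := ζ) hk hlam hlam1 hR x ht'.2) hσ
    have h5 : ((minPFragility (kernelMetric k) F τ p).toReal : ℝ) = κ := rfl
    rw [ucb] at h1
    refine max_le ?_ (by positivity)
    rw [h5]
    linarith
  calc rsgRegret (kernelMetric k) F τ p ε x T
      ≤ ∑ t ∈ Finset.Icc 1 T,
          2 * beta k lam B R ζ x T * posteriorStd k lam (firstTerms x (t - 1)) (x t) :=
        Finset.sum_le_sum hterm
    _ = 2 * beta k lam B R ζ x T
          * ∑ t ∈ Finset.Icc 1 T, posteriorStd k lam (firstTerms x (t - 1)) (x t) :=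
        (Finset.mul_sum _ _ _).symm
    _ ≤ 2 * beta k lam B R ζ x T * (2 * √(T * maxInfoGain k lam T)) := by
        gcongr
        exact sum_posteriorStd_le hk hlam hlam1 hk1 x T
    _ = _ := by ring

end Regret

/-! ### The canonical feature map `x ↦ RKHS.kerFun H x 1`. -/

section RKHS

open scoped RealInnerProductSpace

variable {X : Type*} {H : Type*} [NormedAddCommGroup H] [InnerProductSpace ℝ H] [CompleteSpace H]
  [RKHS ℝ H X ℝ]

theorem reproducingKernel_eq_inner (x x' : X) :
    reproducingKernel H x x' = ⟪RKHS.kerFun H x 1, RKHS.kerFun H x' 1⟫ := by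
  rw [RKHS.kerFun_inner, RKHS.kerFun_apply]
  simp [reproducingKernel]

theorem apply_eq_inner_kerFun (f : H) (x : X) : f x = ⟪RKHS.kerFun H x 1, f⟫ := by
  simp

end RKHS

end AdveRS

theorem mainTheorem3
    -- the domain, the function space and the unknown function
    {m : ℕ} (𝒳 : Set (EuclideanSpace ℝ (Fin m)))
    (H : Type*) [NormedAddCommGroup H] [InnerProductSpace ℝ H] [CompleteSpace H] [RKHS ℝ H 𝒳 ℝ]
    (f : H) (B : ℝ) (hB : ‖f‖ ≤ B)
    -- the kernel is measurable and normalized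
    (hk_meas : Measurable (Function.uncurry (AdveRS.reproducingKernel (X := 𝒳) H)))
    (hk_le : ∀ x : 𝒳, AdveRS.reproducingKernel H x x ≤ 1)
    -- the parameters
    (lam : ℝ) (hlam_pos : 0 < lam) (hlam_le : lam ≤ 1)
    (R : ℝ) (hR : 0 ≤ R)
    (ζ : ℝ) (hζ : ζ ∈ Set.Ioo (0 : ℝ) 1)
    (p : ℝ) (hp : 1 ≤ p)
    -- the threshold is attained, and for `p > 1` the RS-G problem is feasible
    (τ : ℝ) (hτ : ∃ x : 𝒳, τ ≤ f x)
    (hfeas : 1 < p →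
      AdveRS.minPFragility (AdveRS.kernelMetric (AdveRS.reproducingKernel H)) f τ p ≠ ⊤)
    -- the random run of the algorithm
    {Ω : Type*} [mΩ : MeasurableSpace Ω] (P : MeasureTheory.Measure Ω)
    [MeasureTheory.IsProbabilityMeasure P]
    (T : ℕ) (ε : ℕ → ℝ)
    (xSel : ℕ → Ω → 𝒳) (δ : ℕ → Ω → EuclideanSpace ℝ (Fin m)) (x : ℕ → Ω → 𝒳)
    (y η : ℕ → Ω → ℝ)
    (hrun : ∀ ω, AdveRS.IsAdveRSGRun (AdveRS.reproducingKernel H) lam B R ζ τ p f ε T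
      (fun t => xSel t ω) (fun t => δ t ω) (fun t => x t ω) (fun t => y t ω) (fun t => η t ω))
    -- the noise is conditionally `R`-subgaussian given the past
    (ℱ : MeasureTheory.Filtration ℕ mΩ)
    (hx : ∀ t ∈ Finset.Icc 1 T, Measurable[ℱ (t - 1)] (x t))
    (hη : ∀ t ∈ Finset.Icc 1 T, Measurable[ℱ t] (η t))
    (hη_sub : ∀ t ∈ Finset.Icc 1 T, AdveRS.IsCondSubgaussian P (ℱ (t - 1)) (η t) R) :
    ENNReal.ofReal (1 - ζ) ≤
      P {ω | AdveRS.rsgRegret (AdveRS.kernelMetric (AdveRS.reproducingKernel H)) f τ p ε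
            (fun t => x t ω) T
          ≤ 4 * AdveRS.beta (AdveRS.reproducingKernel H) lam B R ζ (fun t => x t ω) T
            * √(T * AdveRS.maxInfoGain (AdveRS.reproducingKernel (X := 𝒳) H) lam T)} := by
  have hk := AdveRS.reproducingKernel_eq_inner (X := 𝒳) (H := H)
  have hF := AdveRS.apply_eq_inner_kerFun (X := 𝒳) f
  have hκ : AdveRS.minPFragility (AdveRS.kernelMetric (AdveRS.reproducingKernel H)) f τ p ≠ ⊤ := by
    rcases hp.eq_or_lt with rfl | hp1
    · exact AdveRS.minPFragility_one_ne_top hk hF hτ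
    · exact hfeas hp1
  -- The inclusion of events holds pointwise, and monotonicity of `P` needs no measurability of the
  -- regret event.
  refine (AdveRS.le_measure_noiseEnergy_le hk hlam_pos hk_meas hR hζ.1 hx hη hη_sub).trans
    (measure_mono fun ω hω => ?_)
  exact (hrun ω).rsgRegret_le hk hlam_pos hlam_le hk_le hR hB hF (by linarith) hκ hω
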